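/- Let $n\ge 0$ be an integer, $M=\{1,\dots,n\}$ and let $M'=\{1',\dots,n'\}$ be a disjoint copy of $M$. Let $\mathfrak{C}_n$ be the set of all decompositions of $M\cup M'$ into disjoint non-empty blocks. It is a monoid under the following product: for $\alpha,\beta\in\mathfrak{C}_n$, identify each $j'$ of $\alpha$ with the element $j$ of $\beta$ $(1\le j\le n)$; two elements of $M$ (of $\alpha$) and $M'$ (of $\beta$) lie in the same block of $\alpha\beta$ if and only if they are connected by a finite chain in which any two consecutive elements lie in one block of $\alpha$ or in one block of $\beta$. The identity is the decomposition with blocks $\{j,j'\}$, $j\in M$. The partial Brauer (rook Brauer) monoid $\mathcal{P}\mathfrak{B}_n$ is the submonoid of all $\alpha\in\mathfrak{C}_n$ each of whose blocks is a line (a two-element block meeting both $M$ and $M'$), a bracket (a two-element block contained in $M$ or in $M'$) or a point (a one-element block). For $1\le i\le n-1$ let $s_i$ be the element with blocks $\{i,(i+1)'\}$, $\{i+1,i'\}$ and $\{j,j'\}$ for $j\ne i,i+1$, and let $\pi_i$ be the element with blocks $\{i,i+1\}$, $\{i',(i+1)'\}$ and $\{j,j'\}$ for $j\neq i,i+1$.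 For $1\le i\le n$ let $\varsigma_i$ be the element with blocks $\{i\}$, $\{i'\}$ and $\{j,j'\}$ for $j\ne i$. **Theorem.** Let $T$ be the monoid with identity $e$ generated by $\sigma_i,\theta_i$ $(1\le i\le n-1)$ and $\vartheta_i$ $(1\le i\le n)$ subject to the following relations, for all indices for which they make sense: $$\sigma_i^2=e;\quad \sigma_i\sigma_j=\sigma_j\sigma_i,\ |i-j|>1;\quad \sigma_i\sigma_j\sigma_i=\sigma_j\sigma_i\sigma_j,\ |i-j|=1;$$ $$\theta_i^2=\theta_i;\quad \theta_i\theta_j=\theta_j\theta_i,\ |i-j|>1;\quad \theta_i\theta_j\theta_i=\theta_i,\ |i-j|=1;$$ $$\theta_i\sigma_i=\sigma_i\theta_i=\theta_i;\quad \theta_i\sigma_j=\sigma_j\theta_i,\ |i-j|>1;$$ $$\sigma_i\theta_j\theta_i=\sigma_j\theta_i,\quad \theta_i\theta_j\sigma_i=\theta_i\sigma_j,\ |i-j|=1;$$ $$\vartheta_i^2=\vartheta_i;\quad \vartheta_i\vartheta_j=\vartheta_j\vartheta_i,\ i\neq j;$$ $$\sigma_i\vartheta_i=\vartheta_{i+1}\sigma_i;\quad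 \sigma_i\vartheta_j=\vartheta_j\sigma_i,\ j\neq i,i+1;\quad \vartheta_i\sigma_i\vartheta_i=\vartheta_i\vartheta_{i+1};$$ $$\theta_i\vartheta_j=\vartheta_j\theta_i,\ j\ne i,i+1;$$ $$\theta_i\vartheta_i=\theta_i\vartheta_{i+1}=\theta_i\vartheta_i\vartheta_{i+1},\quad \vartheta_i\theta_i=\vartheta_{i+1}\theta_i=\vartheta_i\vartheta_{i+1}\theta_i;$$ $$\theta_i\vartheta_i\theta_i=\theta_i,\quad \vartheta_i\theta_i\vartheta_i=\vartheta_i\vartheta_{i+1}.$$ Then the map $\sigma_i\mapsto s_i$, $\theta_i\mapsto\pi_i$ $(1\le i\le n-1)$, $\vartheta_i\mapsto\varsigma_i$ $(1\le i\le n)$ extends to an isomorphism of monoids $\varphi:T\to\mathcal{P}\mathfrak{B}_n$. -/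

import Mathlib

/-- The elements of `𝕮ₙ`: decompositions of `M ∪ M'` into disjoint blocks, encoded as equivalence
relations on `Fin n ⊕ Fin n`. Here `Sum.inl i` is the left pin `i ∈ M`, and `Sum.inr i` is the
right pin `i' ∈ M'` (indices run from `0` to `n - 1`). -/
@[ext]
structure PartitionMonoid (n : ℕ) where
  /-- The relation "lies in the same block". -/
  rel : Setoid (Fin n ⊕ Fin n)

namespace PartitionMonoid

variable {n : ℕ}

/-- The pins occurring when two diagrams are put next to each other: the left pins of the first
one, the identified pins in the middle, and the right pins of the second one. -/
inductive Pin (n : ℕ) : Type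
  | left (i : Fin n) : Pin n
  | mid (i : Fin n) : Pin n
  | right (i : Fin n) : Pin n

/-- The pins of the first diagram. -/
def Pin.ofFst : Fin n ⊕ Fin n → Pin n := Sum.elim Pin.left Pin.mid

/-- The pins of the second diagram. -/
def Pin.ofSnd : Fin n ⊕ Fin n → Pin n := Sum.elim Pin.mid Pin.right

/-- The pins of the product. -/
def Pin.ofOuter : Fin n ⊕ Fin n → Pin n := Sum.elim Pin.left Pin.right

/-- Elementary connections in the juxtaposition of `α` and `β`. -/
inductive Link (α β : PartitionMonoid n) : Pin n → Pin n → Prop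
  | fst {a b : Fin n ⊕ Fin n} (h : α.rel a b) : Link α β (Pin.ofFst a) (Pin.ofFst b)
  | snd {a b : Fin n ⊕ Fin n} (h : β.rel a b) : Link α β (Pin.ofSnd a) (Pin.ofSnd b)

/-- The product `αβ`: the right pins of `α` are identified with the corresponding left pins of
`β`; two outer pins lie in one block of `αβ` if and only if they are connected by a finite chain
of connections in `α` and in `β`. Components without outer pins disappear. -/
instance : Mul (PartitionMonoid n) where
  mul α β := ⟨(Relation.EqvGen.setoid (Link α β)).comap Pin.ofOuter⟩

/-- The diagram of the finest decomposition in which any two pins related by `r` lie in one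
block. -/
def generate (r : Fin n ⊕ Fin n → Fin n ⊕ Fin n → Prop) : PartitionMonoid n :=
  ⟨Relation.EqvGen.setoid r⟩

/-- The diagram of a permutation `w`, with the lines `{j, w(j)'}`. -/
def ofPerm (w : Equiv.Perm (Fin n)) : PartitionMonoid n :=
  generate fun a b => ∃ j, a = Sum.inl j ∧ b = Sum.inr (w j)

/-- The identity diagram, with the lines `{j, j'}`. -/
instance : One (PartitionMonoid n) where
  one := ofPerm 1

theorem mul_rel (α β : PartitionMonoid n) (a b : Fin n ⊕ Fin n) :
    (α * β).rel a b ↔ Relation.EqvGen (Link α β) (Pin.ofOuter a) (Pin.ofOuter b) :=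
  Iff.rfl

/-- `(c, d)` is a 2-colouring of the left and right pins which is constant on the blocks. -/
def Respects (α : PartitionMonoid n) (c d : Fin n → Prop) : Prop :=
  ∀ a b, α.rel a b → (Sum.elim c d a ↔ Sum.elim c d b)

theorem ext_respects {α β : PartitionMonoid n} (h : ∀ c d, α.Respects c d ↔ β.Respects c d) :
    α = β := by
  have key : ∀ {α β : PartitionMonoid n}, (∀ c d, α.Respects c d → β.Respects c d) →
      ∀ a b, β.rel a b → α.rel a b := by
    intro α β h a b hab
    have he : ∀ x, Sum.elim (fun i => α.rel a (Sum.inl i)) (fun i => α.rel a (Sum.inr i)) x ↔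
        α.rel a x := by
      rintro (x | x) <;> rfl
    have h1 := h (fun i => α.rel a (Sum.inl i)) (fun i => α.rel a (Sum.inr i)) (by
      intro x y hxy
      rw [he, he]
      exact ⟨fun h => α.rel.trans' h hxy, fun h => α.rel.trans' h (α.rel.symm' hxy)⟩) a b hab
    rw [he, he] at h1
    exact h1.1 (α.rel.refl' a)
  apply PartitionMonoid.ext
  ext a b
  exact ⟨key (fun c d => (h c d).2) a b, key (fun c d => (h c d).1) a b⟩

theorem generate_respects (r : Fin n ⊕ Fin n → Fin n ⊕ Fin n → Prop) (c d : Fin n → Prop) :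
    (generate r).Respects c d ↔ ∀ a b, r a b → (Sum.elim c d a ↔ Sum.elim c d b) := by
  constructor
  · intro h a b hab
    exact h a b (Relation.EqvGen.rel _ _ hab)
  · intro h a b hab
    induction hab with
    | rel _ _ h' => exact h _ _ h'
    | refl => rfl
    | symm _ _ _ ih => exact ih.symm
    | trans _ _ _ _ _ ih1 ih2 => exact ih1.trans ih2

theorem one_respects (c d : Fin n → Prop) : (1 : PartitionMonoid n).Respects c d ↔ c = d := by
  refine (generate_respects _ c d).trans ⟨fun h => ?_, ?_⟩
  · funext i
    exact propext (h (Sum.inl i) (Sum.inr i) ⟨i, rfl, rfl⟩)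
  · rintro rfl a b ⟨j, rfl, rfl⟩
    rfl

theorem mul_respects (α β : PartitionMonoid n) (c e : Fin n → Prop) :
    (α * β).Respects c e ↔ ∃ d, α.Respects c d ∧ β.Respects d e := by
  constructor
  · intro h
    let C : Pin n → Prop := fun p =>
      ∃ a, Sum.elim c e a ∧ Relation.EqvGen (Link α β) (Pin.ofOuter a) p
    have hC : ∀ p q, Relation.EqvGen (Link α β) p q → (C p ↔ C q) := by
      intro p q hpq
      constructor
      · rintro ⟨a, ha, h'⟩
        exact ⟨a, ha, h'.trans _ _ _ hpq⟩
      · rintro ⟨a, ha, h'⟩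
        exact ⟨a, ha, h'.trans _ _ _ (hpq.symm _ _)⟩
    have hO : ∀ a, C (Pin.ofOuter a) ↔ Sum.elim c e a := by
      intro a
      constructor
      · rintro ⟨b, hb, h'⟩
        exact (h b a h').1 hb
      · intro ha
        exact ⟨a, ha, Relation.EqvGen.refl _⟩
    refine ⟨fun i => C (Pin.mid i), ?_, ?_⟩
    · have he : ∀ a, Sum.elim c (fun i => C (Pin.mid i)) a ↔ C (Pin.ofFst a) := by
        rintro (i | i)
        · exact (hO (Sum.inl i)).symm
        · rfl
      intro a b hab
      rw [he, he]
      exact hC _ _ (Relation.EqvGen.rel _ _ (Link.fst hab))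
    · have he : ∀ a, Sum.elim (fun i => C (Pin.mid i)) e a ↔ C (Pin.ofSnd a) := by
        rintro (i | i)
        · rfl
        · exact (hO (Sum.inr i)).symm
      intro a b hab
      rw [he, he]
      exact hC _ _ (Relation.EqvGen.rel _ _ (Link.snd hab))
  · rintro ⟨d, h1, h2⟩
    let C : Pin n → Prop := fun p => match p with
      | Pin.left i => c i
      | Pin.mid i => d i
      | Pin.right i => e i
    have hC : ∀ p q, Relation.EqvGen (Link α β) p q → (C p ↔ C q) := by
      intro p q hpq
      induction hpq with
      | rel p q h' =>
        cases h' with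
        | @fst a b h' => rcases a with a | a <;> rcases b with b | b <;> exact h1 _ _ h'
        | @snd a b h' => rcases a with a | a <;> rcases b with b | b <;> exact h2 _ _ h'
      | refl => rfl
      | symm _ _ _ ih => exact ih.symm
      | trans _ _ _ _ _ ih1 ih2 => exact ih1.trans ih2
    intro a b hab
    have := hC _ _ hab
    rcases a with a | a <;> rcases b with b | b <;> exact this

instance : Monoid (PartitionMonoid n) where
  mul_assoc α β γ := ext_respects fun c d => by
    simp only [mul_respects]
    constructor
    · rintro ⟨y, ⟨x, h1, h2⟩, h3⟩
      exact ⟨x, h1, y, h2, h3⟩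
    · rintro ⟨x, h1, y, h2, h3⟩
      exact ⟨y, ⟨x, h1, h2⟩, h3⟩
  one_mul α := ext_respects fun c d => by
    simp [mul_respects, one_respects]
  mul_one α := ext_respects fun c d => by
    simp [mul_respects, one_respects]

/-- The set `M` of left pins. -/
def leftPins (n : ℕ) : Set (Fin n ⊕ Fin n) := Set.range Sum.inl

/-- The set `M'` of right pins. -/
def rightPins (n : ℕ) : Set (Fin n ⊕ Fin n) := Set.range Sum.inr

/-- A line has two elements and meets both `M` and `M'`. -/
def IsLine (X : Set (Fin n ⊕ Fin n)) : Prop :=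
  X.ncard = 2 ∧ (X ∩ leftPins n).Nonempty ∧ (X ∩ rightPins n).Nonempty

/-- A bracket has two elements and is contained in `M` or in `M'`. -/
def IsBracket (X : Set (Fin n ⊕ Fin n)) : Prop :=
  X.ncard = 2 ∧ (X ⊆ leftPins n ∨ X ⊆ rightPins n)

/-- A point is a one-element set. -/
def IsPoint (X : Set (Fin n ⊕ Fin n)) : Prop :=
  X.ncard = 1

/-- Every block is a line, a bracket or a point. -/
def IsPartialBrauer (α : PartitionMonoid n) : Prop :=
  ∀ X ∈ α.rel.classes, IsLine X ∨ IsBracket X ∨ IsPoint X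

theorem isPartialBrauer_iff (α : PartitionMonoid n) :
    α.IsPartialBrauer ↔ ∀ a b c, α.rel a b → α.rel a c → a ≠ b → a ≠ c → b = c := by
  constructor
  · intro h a b c hab hac nab nac
    have hle : {x | α.rel x a}.ncard ≤ 2 := by
      rcases h _ (α.rel.mem_classes a) with h | h | h
      · exact h.1.le
      · exact h.1.le
      · exact le_trans (le_of_eq h) (by norm_num)
    by_contra nbc
    have hsub : ({a, b, c} : Set (Fin n ⊕ Fin n)) ⊆ {x | α.rel x a} := by
      rintro x (rfl | rfl | rfl)
      · exact α.rel.refl' _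
      · exact α.rel.symm' hab
      · exact α.rel.symm' hac
    have h3 : ({a, b, c} : Set (Fin n ⊕ Fin n)).ncard = 3 :=
      Set.ncard_eq_three.2 ⟨a, b, c, nab, nac, nbc, rfl⟩
    have := Set.ncard_le_ncard hsub (Set.toFinite _)
    omega
  · rintro h X ⟨a, rfl⟩
    by_cases hb : ∃ b, α.rel a b ∧ a ≠ b
    · obtain ⟨b, hab, nab⟩ := hb
      have hX : {x | α.rel x a} = {a, b} := by
        ext x
        constructor
        · intro hx
          by_cases hxa : a = x
          · exact Or.inl hxa.symm
          · exact Or.inr (h a x b (α.rel.symm' hx) hab hxa nab)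
        · rintro (rfl | rfl)
          · exact α.rel.refl' _
          · exact α.rel.symm' hab
      have hc : ({a, b} : Set (Fin n ⊕ Fin n)).ncard = 2 := Set.ncard_pair nab
      rw [hX]
      rcases a with a | a <;> rcases b with b | b
      · refine Or.inr (Or.inl ⟨hc, Or.inl ?_⟩)
        rintro x (rfl | rfl) <;> exact ⟨_, rfl⟩
      · exact Or.inl ⟨hc, ⟨_, Or.inl rfl, _, rfl⟩, ⟨_, Or.inr rfl, _, rfl⟩⟩
      · exact Or.inl ⟨hc, ⟨_, Or.inr rfl, _, rfl⟩, ⟨_, Or.inl rfl, _, rfl⟩⟩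
      · refine Or.inr (Or.inl ⟨hc, Or.inr ?_⟩)
        rintro x (rfl | rfl) <;> exact ⟨_, rfl⟩
    · push Not at hb
      refine Or.inr (Or.inr ?_)
      have hX : {x | α.rel x a} = {a} := by
        ext x
        constructor
        · intro hx
          exact (hb x (α.rel.symm' hx)).symm
        · rintro rfl
          exact α.rel.refl' _
      rw [hX]
      exact Set.ncard_singleton a

/-- Steps of alternating walks; the Boolean records whether the last edge was in the second
diagram. -/
inductive Walk (α β : PartitionMonoid n) : Pin n × Bool → Pin n × Bool → Prop
  | fst {a b : Fin n ⊕ Fin n} (h : α.rel a b) (hne : a ≠ b) :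
      Walk α β (Pin.ofFst a, true) (Pin.ofFst b, false)
  | snd {a b : Fin n ⊕ Fin n} (h : β.rel a b) (hne : a ≠ b) :
      Walk α β (Pin.ofSnd a, false) (Pin.ofSnd b, true)

theorem Pin.ofFst_injective : Function.Injective (Pin.ofFst (n := n)) := by
  rintro (a | a) (b | b) h <;> simp_all [Pin.ofFst]

theorem Pin.ofSnd_injective : Function.Injective (Pin.ofSnd (n := n)) := by
  rintro (a | a) (b | b) h <;> simp_all [Pin.ofSnd]

theorem Pin.ofOuter_injective : Function.Injective (Pin.ofOuter (n := n)) := by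
  rintro (a | a) (b | b) h <;> simp_all [Pin.ofOuter]

/-- The initial state of a walk which starts at an outer pin. -/
def start (a : Fin n ⊕ Fin n) : Pin n × Bool := (Pin.ofOuter a, a.isLeft)

/-- The state of a walk which has arrived at an outer pin. -/
def final (a : Fin n ⊕ Fin n) : Pin n × Bool := (Pin.ofOuter a, !a.isLeft)

theorem Walk.rightUnique {α β : PartitionMonoid n} (hα : α.IsPartialBrauer)
    (hβ : β.IsPartialBrauer) : Relator.RightUnique (Walk α β) := by
  rw [isPartialBrauer_iff] at hα hβ
  intro s t u h1 h2
  generalize hs : s = s' at h2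
  cases h1 with
  | @fst a b h hne =>
    cases h2 with
    | @fst a' b' h' hne' =>
      obtain rfl := Pin.ofFst_injective (Prod.ext_iff.1 hs).1
      rw [hα _ _ _ h h' hne hne']
    | @snd a' b' h' hne' => simp at hs
  | @snd a b h hne =>
    cases h2 with
    | @fst a' b' h' hne' => simp at hs
    | @snd a' b' h' hne' =>
      obtain rfl := Pin.ofSnd_injective (Prod.ext_iff.1 hs).1
      rw [hβ _ _ _ h h' hne hne']

theorem Walk.not_to_start {α β : PartitionMonoid n} {s : Pin n × Bool} {a : Fin n ⊕ Fin n} :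
    ¬ Walk α β s (start a) := by
  intro h
  generalize ht : start a = t at h
  cases h with
  | @fst x y h hne => rcases a with a | a <;> rcases y with y | y <;>
      simp [start, Pin.ofOuter, Pin.ofFst] at ht
  | @snd x y h hne => rcases a with a | a <;> rcases y with y | y <;>
      simp [start, Pin.ofOuter, Pin.ofSnd] at ht

theorem Walk.not_from_final {α β : PartitionMonoid n} {s : Pin n × Bool} {a : Fin n ⊕ Fin n} :
    ¬ Walk α β (final a) s := by
  intro h
  generalize ht : final a = t at h
  cases h with
  | @fst x y h hne => rcases a with a | a <;> rcases x with x | x <;>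
      simp [final, Pin.ofOuter, Pin.ofFst] at ht
  | @snd x y h hne => rcases a with a | a <;> rcases x with x | x <;>
      simp [final, Pin.ofOuter, Pin.ofSnd] at ht

theorem exists_walk {α β : PartitionMonoid n} (hα : α.IsPartialBrauer)
    (hβ : β.IsPartialBrauer) (a : Fin n ⊕ Fin n) {p q : Pin n}
    (hpq : Relation.EqvGen (Link α β) p q) :
    (∃ s, Relation.ReflTransGen (Walk α β) (start a) (p, s)) ↔
      ∃ s, Relation.ReflTransGen (Walk α β) (start a) (q, s) := by
  rw [isPartialBrauer_iff] at hα hβ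
  have hfst : ∀ x y, α.rel x y →
      (∃ s, Relation.ReflTransGen (Walk α β) (start a) (Pin.ofFst x, s)) →
      ∃ s, Relation.ReflTransGen (Walk α β) (start a) (Pin.ofFst y, s) := by
    rintro x y hxy ⟨s, hs⟩
    by_cases hne : x = y
    · exact hne ▸ ⟨s, hs⟩
    cases s with
    | true => exact ⟨false, hs.tail (Walk.fst hxy hne)⟩
    | false =>
      rcases Relation.ReflTransGen.cases_tail hs with h | ⟨t, ht, h⟩
      · rcases a with a | a <;> rcases x with x | x <;>
          simp [start, Pin.ofOuter, Pin.ofFst] at h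
      · generalize hu : (Pin.ofFst x, false) = u at h
        cases h with
        | @fst x' z h hne' =>
          obtain rfl := Pin.ofFst_injective (Prod.ext_iff.1 hu).1
          obtain rfl := hα _ _ _ hxy (α.rel.symm' h) hne (Ne.symm hne')
          exact ⟨true, ht⟩
        | @snd x' z h hne' => simp at hu
  have hsnd : ∀ x y, β.rel x y →
      (∃ s, Relation.ReflTransGen (Walk α β) (start a) (Pin.ofSnd x, s)) →
      ∃ s, Relation.ReflTransGen (Walk α β) (start a) (Pin.ofSnd y, s) := by
    rintro x y hxy ⟨s, hs⟩
    by_cases hne : x = y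
    · exact hne ▸ ⟨s, hs⟩
    cases s with
    | false => exact ⟨true, hs.tail (Walk.snd hxy hne)⟩
    | true =>
      rcases Relation.ReflTransGen.cases_tail hs with h | ⟨t, ht, h⟩
      · rcases a with a | a <;> rcases x with x | x <;>
          simp [start, Pin.ofOuter, Pin.ofSnd] at h
      · generalize hu : (Pin.ofSnd x, true) = u at h
        cases h with
        | @fst x' z h hne' => simp at hu
        | @snd x' z h hne' =>
          obtain rfl := Pin.ofSnd_injective (Prod.ext_iff.1 hu).1
          obtain rfl := hβ _ _ _ hxy (β.rel.symm' h) hne (Ne.symm hne')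
          exact ⟨false, ht⟩
  induction hpq with
  | rel p q h =>
    cases h with
    | fst h => exact ⟨hfst _ _ h, hfst _ _ (α.rel.symm' h)⟩
    | snd h => exact ⟨hsnd _ _ h, hsnd _ _ (β.rel.symm' h)⟩
  | refl => rfl
  | symm _ _ _ ih => exact ih.symm
  | trans _ _ _ _ _ ih1 ih2 => exact ih1.trans ih2

theorem IsPartialBrauer.mul {α β : PartitionMonoid n} (hα : α.IsPartialBrauer)
    (hβ : β.IsPartialBrauer) : (α * β).IsPartialBrauer := by
  rw [isPartialBrauer_iff]
  have key : ∀ a b, (α * β).rel a b → a ≠ b →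
      Relation.ReflTransGen (Walk α β) (start a) (final b) := by
    intro a b hab hne
    obtain ⟨s, hs⟩ := (exists_walk hα hβ a hab).1 ⟨_, Relation.ReflTransGen.refl⟩
    by_cases hb : s = b.isLeft
    · subst hb
      rcases Relation.ReflTransGen.cases_tail hs with h | ⟨t, -, h⟩
      · exact absurd (Pin.ofOuter_injective (Prod.ext_iff.1 h).1).symm hne
      · exact absurd h (Walk.not_to_start (a := b))
    · have : s = !b.isLeft := by
        revert hb
        cases s <;> cases b.isLeft <;> simp
      rw [final, ← this]
      exact hs
  have stuck : ∀ a t, Relation.ReflTransGen (Walk α β) (final a) t → t = final a := by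
    intro a t h
    rcases Relation.ReflTransGen.cases_head h with h | ⟨u, h, -⟩
    · exact h.symm
    · exact absurd h Walk.not_from_final
  intro a b c hab hac nab nac
  rcases Relation.ReflTransGen.total_of_right_unique (Walk.rightUnique hα hβ)
    (key a b hab nab) (key a c hac nac) with h | h
  · exact (Pin.ofOuter_injective (Prod.ext_iff.1 (stuck _ _ h)).1).symm
  · exact Pin.ofOuter_injective (Prod.ext_iff.1 (stuck _ _ h)).1

theorem isPartialBrauer_one : (1 : PartitionMonoid n).IsPartialBrauer := by
  rw [isPartialBrauer_iff]
  have key : ∀ a b, Relation.EqvGen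
      (fun a b : Fin n ⊕ Fin n => ∃ j, a = Sum.inl j ∧ b = Sum.inr ((1 : Equiv.Perm (Fin n)) j))
        a b → Sum.elim id id a = Sum.elim id id b := by
    intro a b h
    induction h with
    | rel _ _ h =>
      obtain ⟨j, rfl, rfl⟩ := h
      rfl
    | refl => rfl
    | symm _ _ _ ih => exact ih.symm
    | trans _ _ _ _ _ ih1 ih2 => exact ih1.trans ih2
  intro a b c hab hac nab nac
  have h1 := key a b hab
  have h2 := key a c hac
  clear hab hac key
  rcases a with a | a <;> rcases b with b | b <;> rcases c with c | c <;>
    simp only [Sum.elim_inl, Sum.elim_inr, id] at h1 h2 <;> subst h1 <;> subst h2 <;>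
    first | rfl | exact absurd rfl nab | exact absurd rfl nac

/-- The partial Brauer (rook Brauer) monoid: all diagrams each of whose blocks is a line, a
bracket or a point. -/
def partialBrauer (n : ℕ) : Submonoid (PartitionMonoid n) where
  carrier := {α | α.IsPartialBrauer}
  mul_mem' := fun hα hβ => IsPartialBrauer.mul hα hβ
  one_mem' := isPartialBrauer_one

/-- The element `i` of `{1, …, n}`, for `1 ≤ i ≤ n - 1`. -/
def lo (i : Fin (n - 1)) : Fin n := ⟨i, by omega⟩

/-- The element `i + 1` of `{1, …, n}`, for `1 ≤ i ≤ n - 1`. -/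
def hi (i : Fin (n - 1)) : Fin n := ⟨i + 1, by omega⟩

/-- `sᵢ`, the diagram of the elementary transposition `(i, i+1)`. -/
def s (i : Fin (n - 1)) : PartitionMonoid n := ofPerm (Equiv.swap (lo i) (hi i))

/-- `πᵢ`, with the brackets `{i, i+1}`, `{i', (i+1)'}` and the lines `{j, j'}`, `j ≠ i, i+1`. -/
def pi (i : Fin (n - 1)) : PartitionMonoid n :=
  generate fun a b =>
    (a = Sum.inl (lo i) ∧ b = Sum.inl (hi i)) ∨
    (a = Sum.inr (lo i) ∧ b = Sum.inr (hi i)) ∨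
    ∃ j, j ≠ lo i ∧ j ≠ hi i ∧ a = Sum.inl j ∧ b = Sum.inr j

/-- `ςᵢ`, with the points `{i}`, `{i'}` and the lines `{j, j'}`, `j ≠ i`. -/
def varsigma (i : Fin n) : PartitionMonoid n :=
  generate fun a b => ∃ j, j ≠ i ∧ a = Sum.inl j ∧ b = Sum.inr j

end PartitionMonoid

namespace RookBrauer

open PartitionMonoid (lo hi)

/-- The generators `σᵢ`, `θᵢ` (`1 ≤ i ≤ n - 1`) and `ϑᵢ` (`1 ≤ i ≤ n`). -/
inductive Gen (n : ℕ) : Type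
  | sigma (i : Fin (n - 1)) : Gen n
  | theta (i : Fin (n - 1)) : Gen n
  | vartheta (i : Fin n) : Gen n

/-- The letter `σᵢ`. -/
def σ {n : ℕ} (i : Fin (n - 1)) : FreeMonoid (Gen n) := FreeMonoid.of (Gen.sigma i)

/-- The letter `θᵢ`. -/
def θ {n : ℕ} (i : Fin (n - 1)) : FreeMonoid (Gen n) := FreeMonoid.of (Gen.theta i)

/-- The letter `ϑᵢ`. -/
def ϑ {n : ℕ} (i : Fin n) : FreeMonoid (Gen n) := FreeMonoid.of (Gen.vartheta i)

/-- `|i - j| > 1`. -/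
def Far {m : ℕ} (i j : Fin m) : Prop := (i : ℕ) + 1 < j ∨ (j : ℕ) + 1 < i

/-- `|i - j| = 1`. -/
def Near {m : ℕ} (i j : Fin m) : Prop := (i : ℕ) + 1 = j ∨ (j : ℕ) + 1 = i

/-- The defining relations. -/
inductive Rel (n : ℕ) : FreeMonoid (Gen n) → FreeMonoid (Gen n) → Prop
  -- the relations of the Brauer monoid
  | sigma_sq (i : Fin (n - 1)) : Rel n (σ i * σ i) 1
  | sigma_comm (i j : Fin (n - 1)) (h : Far i j) : Rel n (σ i * σ j) (σ j * σ i)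
  | sigma_braid (i j : Fin (n - 1)) (h : Near i j) :
      Rel n (σ i * σ j * σ i) (σ j * σ i * σ j)
  | theta_sq (i : Fin (n - 1)) : Rel n (θ i * θ i) (θ i)
  | theta_comm (i j : Fin (n - 1)) (h : Far i j) : Rel n (θ i * θ j) (θ j * θ i)
  | theta_theta_theta (i j : Fin (n - 1)) (h : Near i j) : Rel n (θ i * θ j * θ i) (θ i)
  | theta_sigma (i : Fin (n - 1)) : Rel n (θ i * σ i) (θ i)
  | sigma_theta (i : Fin (n - 1)) : Rel n (σ i * θ i) (θ i)
  | theta_sigma_comm (i j : Fin (n - 1)) (h : Far i j) : Rel n (θ i * σ j) (σ j * θ i)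
  | sigma_theta_theta (i j : Fin (n - 1)) (h : Near i j) :
      Rel n (σ i * θ j * θ i) (σ j * θ i)
  | theta_theta_sigma (i j : Fin (n - 1)) (h : Near i j) :
      Rel n (θ i * θ j * σ i) (θ i * σ j)
  -- the further relations of the symmetric inverse monoid
  | vartheta_sq (i : Fin n) : Rel n (ϑ i * ϑ i) (ϑ i)
  | vartheta_comm (i j : Fin n) (h : i ≠ j) : Rel n (ϑ i * ϑ j) (ϑ j * ϑ i)
  | sigma_vartheta (i : Fin (n - 1)) : Rel n (σ i * ϑ (lo i)) (ϑ (hi i) * σ i)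
  | sigma_vartheta_comm (i : Fin (n - 1)) (j : Fin n) (h : j ≠ lo i) (h' : j ≠ hi i) :
      Rel n (σ i * ϑ j) (ϑ j * σ i)
  | vartheta_sigma_vartheta (i : Fin (n - 1)) :
      Rel n (ϑ (lo i) * σ i * ϑ (lo i)) (ϑ (lo i) * ϑ (hi i))
  -- the mixed relations
  | theta_vartheta_comm (i : Fin (n - 1)) (j : Fin n) (h : j ≠ lo i) (h' : j ≠ hi i) :
      Rel n (θ i * ϑ j) (ϑ j * θ i)
  | theta_vartheta_lo_hi (i : Fin (n - 1)) : Rel n (θ i * ϑ (lo i)) (θ i * ϑ (hi i))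
  | theta_vartheta_hi_both (i : Fin (n - 1)) :
      Rel n (θ i * ϑ (hi i)) (θ i * ϑ (lo i) * ϑ (hi i))
  | vartheta_theta_lo_hi (i : Fin (n - 1)) : Rel n (ϑ (lo i) * θ i) (ϑ (hi i) * θ i)
  | vartheta_theta_hi_both (i : Fin (n - 1)) :
      Rel n (ϑ (hi i) * θ i) (ϑ (lo i) * ϑ (hi i) * θ i)
  | theta_vartheta_theta (i : Fin (n - 1)) : Rel n (θ i * ϑ (lo i) * θ i) (θ i)
  | vartheta_theta_vartheta (i : Fin (n - 1)) :
      Rel n (ϑ (lo i) * θ i * ϑ (lo i)) (ϑ (lo i) * ϑ (hi i))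

/-- The monoid `T` given by the above generators and relations. -/
abbrev T (n : ℕ) : Type := PresentedMonoid (Rel n)

end RookBrauer

/-!
The generators satisfy the defining relations, so there is a homomorphism from `T` to the monoid of
diagrams, and its image lies in the partial Brauer monoid. That it is bijective is shown by means of
normal forms, which are the same on both sides.

Consider products `E · w · P · E'` (`NormalForm`), where `E` and `E'` are products of hooks
(conjugates of the `θₖ` under the symmetric group) over the pairs of two matchings, `w` is a
permutation, and `P` is a product of points `ϑᵢ` over a set which contains the support of `E'` and,
up to the permutation `w`, the support of `E`. The diagram of such a product has as brackets the
pairs of the two matchings, and as lines those of `w` that are not cut by `P`. Hence the diagram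
determines the normal form, except for the irrelevant values of `w`
(`NormalForm.le_of_respects`), and every diagram whose blocks are lines, brackets and points
occurs (`NormalForm.exists_respects_iff`). So it suffices to prove in `T` that every element is a
normal form (`T.exists_eval_eq`) and that the irrelevant values of `w` do not affect it
(`RookBrauerSystem.eval_congr`).

For the former, normal forms are multiplied from the right by a permutation, a hook or a point
(`eval_mulPerm`, `exists_eval_eq_mul_hook`, `exists_eval_eq_mul_pt`). Only a few equations between
hooks and points are needed, and these are collected in `RookBrauerSystem`. The essential one is
`e_{ik} e_{ij} = (j k) e_{ij}`: multiplying by a hook one of whose ends lies on a right bracket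
amounts to multiplying by a transposition and then by a hook that meets no right bracket.

These equations are invariant under the symmetric group, so in `T` they follow from their cases
with neighbouring indices (`T.system`). This requires that the symmetric group maps to `T` and
acts by conjugation on hooks. Both facts come from the coset decomposition in the proof of the
Coxeter presentation: an element of the group generated by the `σₖ` with `k ≥ j` whose permutation
fixes `j` is a product of `σₖ` with `k ≥ j + 1` (`IsCoxeterFamily.mem_tail_succ`). It implies that
the permutation determines the product of the `σₖ`, and that a permutation which fixes the first
two points commutes with the first `θ`, so that conjugates of the `θₖ` depend only on the place of
their bracket (`T.conjHom_the_eq_of_sym2`).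

Equalities of diagrams are checked on two-colourings which are constant on the blocks (`Respects`),
because the colourings of a product are obtained by composing relations.
-/

namespace RookBrauer

open PartitionMonoid (lo hi)

/-! ### The Coxeter presentation of the symmetric group -/

theorem lo_ne_hi {n : ℕ} (k : Fin (n - 1)) : lo k ≠ hi k := by
  simp [lo, hi, Fin.ext_iff]

/-- The elementary transpositions in the symmetric group on `Fin n`. -/
def adjSwap {n : ℕ} (k : Fin (n - 1)) : Equiv.Perm (Fin n) := Equiv.swap (lo k) (hi k)

theorem closure_adjSwap (n : ℕ) :
    Submonoid.closure (Set.range (adjSwap : Fin (n - 1) → Equiv.Perm (Fin n))) = ⊤ := by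
  cases n with
  | zero => exact Subsingleton.elim _ _
  | succ m => exact Equiv.Perm.mclosure_swap_castSucc_succ m

/-- The relations of the symmetric group, for a family of elements of a group. -/
structure IsCoxeterFamily {m : ℕ} {Γ : Type*} [Group Γ] (X : Fin m → Γ) : Prop where
  sq (i : Fin m) : X i * X i = 1
  comm (i j : Fin m) (h : Far i j) : X i * X j = X j * X i
  braid (i j : Fin m) (h : Near i j) : X i * X j * X i = X j * X i * X j

theorem isCoxeterFamily_adjSwap (n : ℕ) :
    IsCoxeterFamily (adjSwap : Fin (n - 1) → Equiv.Perm (Fin n)) where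
  sq i := Equiv.swap_mul_self _ _
  comm i j h := by
    refine Equiv.Perm.Disjoint.commute ?_
    intro x
    by_cases hx : x = lo i ∨ x = hi i
    · right
      refine Equiv.swap_apply_of_ne_of_ne ?_ ?_ <;> rintro rfl <;>
        rcases hx with hx | hx <;> rcases h with h | h <;>
        simp only [lo, hi, Fin.ext_iff] at hx <;> omega
    · left
      push Not at hx
      exact Equiv.swap_apply_of_ne_of_ne hx.1 hx.2
  braid i j h := by
    have key : ∀ a b c : Fin n, a ≠ b → b ≠ c → a ≠ c →
        Equiv.swap a b * Equiv.swap b c * Equiv.swap a b =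
          Equiv.swap b c * Equiv.swap a b * Equiv.swap b c := by
      intro a b c hab hbc hac
      rw [Equiv.swap_mul_swap_mul_swap hab hac, Equiv.swap_comm a b, Equiv.swap_comm b c,
        Equiv.swap_mul_swap_mul_swap hbc.symm hac.symm, Equiv.swap_comm]
    rcases h with h | h
    · have e : hi i = lo j := Fin.ext h
      simp only [adjSwap, e]
      exact key _ _ _ (e ▸ lo_ne_hi i) (lo_ne_hi j) (by simp [lo, hi, Fin.ext_iff]; omega)
    · have e : hi j = lo i := Fin.ext h
      simp only [adjSwap, e]
      exact (key _ _ _ (e ▸ lo_ne_hi j) (lo_ne_hi i) (by simp [lo, hi, Fin.ext_iff]; omega)).symm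

namespace IsCoxeterFamily

variable {m : ℕ} {Γ : Type*} [Group Γ] {X : Fin m → Γ}

/-- The subgroup generated by the `X k` with `j ≤ k`. -/
def tail (X : Fin m → Γ) (j : ℕ) : Subgroup Γ :=
  Subgroup.closure {x | ∃ k : Fin m, j ≤ k ∧ X k = x}

theorem mem_tail {j : ℕ} (k : Fin m) (h : j ≤ k) : X k ∈ tail X j :=
  Subgroup.subset_closure ⟨k, h, rfl⟩

/-- The product `X (j + l - 1) ⋯ X (j + 1) * X j`; indices that are out of range are skipped. -/
def chain (X : Fin m → Γ) (j : ℕ) : ℕ → Γ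
  | 0 => 1
  | l + 1 => (if h : j + l < m then X ⟨j + l, h⟩ else 1) * chain X j l

theorem chain_succ {j l : ℕ} (h : j + l < m) :
    chain X j (l + 1) = X ⟨j + l, h⟩ * chain X j l := by
  simp [chain, h]

theorem mul_chain_of_lt (hX : IsCoxeterFamily X) (j l : ℕ) (k : Fin m) (hl : j + l ≤ m)
    (hk : j + l < k) : X k * chain X j l = chain X j l * X k := by
  induction l with
  | zero => simp [chain]
  | succ l ih =>
    rw [chain_succ (by omega), ← mul_assoc, hX.comm k _ (Or.inr (by simp; omega)), mul_assoc,
      ih (by omega) (by omega), mul_assoc]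

/-- Moving a generator past the chain raises its index by one. -/
theorem mul_chain_of_gt (hX : IsCoxeterFamily X) (j l k : ℕ) (hl : j + l ≤ m)
    (hk : j ≤ k) (hk' : k + 1 < j + l) :
    X ⟨k, by omega⟩ * chain X j l = chain X j l * X ⟨k + 1, by omega⟩ := by
  induction l with
  | zero => omega
  | succ l ih =>
    rw [chain_succ (by omega)]
    by_cases h : k + 1 < j + l
    · rw [← mul_assoc, hX.comm _ _ (Or.inl (by simp; omega)), mul_assoc, ih (by omega) h, mul_assoc]
    · obtain ⟨r, rfl⟩ : ∃ r, l = r + 1 := ⟨l - 1, by omega⟩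
      obtain rfl : k = j + r := by omega
      rw [chain_succ (by omega), ← mul_assoc, ← mul_assoc]
      have h2 := hX.braid ⟨j + r, by omega⟩ ⟨j + (r + 1), by omega⟩ (Or.inl (by simp; omega))
      rw [h2, mul_assoc, mul_chain_of_lt hX j r ⟨j + (r + 1), by omega⟩ (by omega) (by simp)]
      simp only [mul_assoc]
      rfl

/-- The elements `chain X j l` represent all left cosets of `tail X (j + 1)` in `tail X j`, because
these cosets are permuted by the generators. -/
theorem exists_chain_mul (hX : IsCoxeterFamily X) {j : ℕ} (hj : j ≤ m) {t : Γ}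
    (ht : t ∈ tail X j) :
    ∃ l, j + l ≤ m ∧ ∃ h ∈ tail X (j + 1), t = chain X j l * h := by
  have step : ∀ k : Fin m, j ≤ k → ∀ t, (∃ l, j + l ≤ m ∧ ∃ h ∈ tail X (j + 1),
      t = chain X j l * h) → ∃ l, j + l ≤ m ∧ ∃ h ∈ tail X (j + 1), X k * t = chain X j l * h := by
    rintro k hk t ⟨l, hl, h, hh, rfl⟩
    rcases lt_trichotomy (k : ℕ) (j + l) with hkl | hkl | hkl
    · by_cases hk' : (k : ℕ) + 1 < j + l
      · refine ⟨l, hl, X ⟨k + 1, by omega⟩ * h, mul_mem (mem_tail _ (by simpa)) hh, ?_⟩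
        rw [← mul_assoc, hX.mul_chain_of_gt j l k hl hk hk', mul_assoc]
      · obtain ⟨r, rfl⟩ : ∃ r, l = r + 1 := ⟨l - 1, by omega⟩
        have hkr : (⟨j + r, by omega⟩ : Fin m) = k := Fin.ext (by simp; omega)
        refine ⟨r, by omega, h, hh, ?_⟩
        rw [← hkr, chain_succ (by omega), ← mul_assoc, ← mul_assoc, hX.sq, one_mul]
    · refine ⟨l + 1, by omega, h, hh, ?_⟩
      have hkr : (⟨j + l, by omega⟩ : Fin m) = k := Fin.ext hkl.symm
      rw [← hkr, chain_succ (by omega), mul_assoc]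
    · refine ⟨l, hl, X k * h, mul_mem (mem_tail _ (by omega)) hh, ?_⟩
      rw [← mul_assoc, hX.mul_chain_of_lt j l k hl hkl, mul_assoc]
  induction ht using Subgroup.closure_induction_left with
  | one => exact ⟨0, hj, 1, one_mem _, by simp [chain]⟩
  | mul_left x hx y _ ih =>
    obtain ⟨k, hk, rfl⟩ := hx
    exact step k hk _ ih
  | inv_mul_cancel x hx y _ ih =>
    obtain ⟨k, hk, rfl⟩ := hx
    rw [inv_eq_of_mul_eq_one_left (hX.sq k)]
    exact step k hk _ ih

end IsCoxeterFamily

section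

variable {n : ℕ} {Γ : Type*} [Group Γ] {X : Fin (n - 1) → Γ}

open IsCoxeterFamily

/-- If an element of `tail X j` induces a permutation which fixes `j`, then it lies in
`tail X (j + 1)`. -/
theorem IsCoxeterFamily.mem_tail_succ (hX : IsCoxeterFamily X) (π : Γ →* Equiv.Perm (Fin n))
    (hπ : ∀ k, π (X k) = adjSwap k) {j : ℕ} (hj : j < n) {t : Γ} (ht : t ∈ tail X j)
    (hfix : π t ⟨j, hj⟩ = ⟨j, hj⟩) : t ∈ tail X (j + 1) := by
  obtain ⟨l, hl, h, hh, rfl⟩ := hX.exists_chain_mul (by omega) ht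
  have hchain : ∀ l, (hl : j + l ≤ n - 1) → π (chain X j l) ⟨j, hj⟩ = ⟨j + l, by omega⟩ := by
    intro l hl
    induction l with
    | zero => simp [chain]
    | succ l ih =>
      rw [chain_succ (by omega), map_mul, Equiv.Perm.mul_apply, ih (by omega), hπ]
      exact Equiv.swap_apply_left _ _
  have htail : π h ⟨j, hj⟩ = ⟨j, hj⟩ := by
    have : tail X (j + 1) ≤
        (MulAction.stabilizer (Equiv.Perm (Fin n)) (⟨j, hj⟩ : Fin n)).comap π := by
      refine (Subgroup.closure_le _).2 ?_
      rintro _ ⟨k, hk, rfl⟩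
      rw [SetLike.mem_coe, Subgroup.mem_comap, MulAction.mem_stabilizer_iff, hπ]
      refine Equiv.swap_apply_of_ne_of_ne ?_ ?_ <;> simp [lo, hi, Fin.ext_iff] <;> omega
    exact this hh
  rw [map_mul, Equiv.Perm.mul_apply, htail, hchain l hl, Fin.ext_iff] at hfix
  obtain rfl : l = 0 := by simpa using hfix
  simpa [chain] using hh

/-- A family of elements of a group which satisfies the Coxeter relations, and which lies over the
elementary transpositions, defines a section of the projection to the symmetric group; if `w`
fixes all `i < j` then the section at `w` is a product of generators of index at least `j`. -/
theorem IsCoxeterFamily.exists_section (hX : IsCoxeterFamily X) (π : Γ →* Equiv.Perm (Fin n))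
    (hπ : ∀ k, π (X k) = adjSwap k) :
    ∃ f : Equiv.Perm (Fin n) →* Γ, (∀ k, f (adjSwap k) = X k) ∧
      ∀ j ≤ n, ∀ w : Equiv.Perm (Fin n), (∀ i : Fin n, (i : ℕ) < j → w i = i) → f w ∈ tail X j := by
  have hmem : ∀ t ∈ tail X 0, ∀ j ≤ n, (∀ i : Fin n, (i : ℕ) < j → π t i = i) → t ∈ tail X j := by
    intro t ht j
    induction j with
    | zero => exact fun _ _ => ht
    | succ j ih =>
      intro hj hfix
      exact hX.mem_tail_succ π hπ (by omega) (ih (by omega) fun i hi => hfix i (by omega))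
        (hfix ⟨j, by omega⟩ (by simp))
  -- Restricted to the subgroup generated by the family, the projection is bijective.
  let ψ : tail X 0 →* Equiv.Perm (Fin n) := π.comp (tail X 0).subtype
  have hinj : Function.Injective ψ := by
    refine (injective_iff_map_eq_one ψ).2 ?_
    rintro ⟨t, ht⟩ h1
    have h1 : π t = 1 := h1
    have h2 : t ∈ tail X n := hmem t ht n le_rfl (by simp [h1])
    have h3 : tail X n = ⊥ := by
      rw [tail, Subgroup.closure_eq_bot_iff]
      rintro _ ⟨k, hk, -⟩
      omega
    rw [h3, Subgroup.mem_bot] at h2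
    exact Subtype.ext h2
  have hsurj : Function.Surjective ψ := by
    rw [← MonoidHom.mrange_eq_top, eq_top_iff, ← closure_adjSwap, Submonoid.closure_le]
    rintro _ ⟨k, rfl⟩
    exact ⟨⟨X k, mem_tail k (Nat.zero_le _)⟩, hπ k⟩
  let E := MulEquiv.ofBijective ψ ⟨hinj, hsurj⟩
  have hE : ∀ w, π (E.symm w : Γ) = w := fun w => E.apply_symm_apply w
  refine ⟨(tail X 0).subtype.comp E.symm.toMonoidHom, fun k => ?_, fun j hj w hw => ?_⟩
  · have : E ⟨X k, mem_tail k (Nat.zero_le _)⟩ = adjSwap k := hπ k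
    exact congrArg Subtype.val ((MulEquiv.symm_apply_eq E).2 this.symm)
  · refine hmem _ (E.symm w).2 j hj fun i hi => ?_
    rw [hE, hw i hi]

end

end RookBrauer

namespace RookBrauer

/-! ### Normal forms -/

section NormalForms

variable {α : Type*}

/-- A set of pairwise disjoint two-element sets. -/
structure IsMatching (F : Finset (Sym2 α)) : Prop where
  irrefl (i : α) : s(i, i) ∉ F
  unique {i j k : α} (hj : s(i, j) ∈ F) (hk : s(i, k) ∈ F) : j = k

theorem IsMatching.mono {F F' : Finset (Sym2 α)} (hF : IsMatching F) (h : F' ⊆ F) :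
    IsMatching F' :=
  ⟨fun i hi => hF.irrefl i (h hi), fun hj hk => hF.unique (h hj) (h hk)⟩

theorem IsMatching.ne {F : Finset (Sym2 α)} (hF : IsMatching F) {i j : α} (h : s(i, j) ∈ F) :
    i ≠ j := by
  rintro rfl
  exact hF.irrefl _ h

theorem isMatching_empty : IsMatching (∅ : Finset (Sym2 α)) :=
  ⟨by simp, by simp⟩

variable [DecidableEq α]

/-- The image of a set of pairs under a permutation. -/
def permPairs (w : Equiv.Perm α) (F : Finset (Sym2 α)) : Finset (Sym2 α) :=
  F.image (Sym2.map w)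

theorem mem_permPairs {w : Equiv.Perm α} {F : Finset (Sym2 α)} {i j : α} :
    s(i, j) ∈ permPairs w F ↔ s(w⁻¹ i, w⁻¹ j) ∈ F := by
  rw [permPairs, Finset.mem_image]
  constructor
  · rintro ⟨z, hz, h⟩
    have : z = Sym2.map (w⁻¹ : Equiv.Perm α) s(i, j) := by
      rw [← h, Sym2.map_map]
      simp
    rwa [this] at hz
  · intro h
    exact ⟨_, h, by simp⟩

theorem IsMatching.permPairs {F : Finset (Sym2 α)} (hF : IsMatching F) (w : Equiv.Perm α) :
    IsMatching (permPairs w F) where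
  irrefl _ hi := hF.irrefl _ (mem_permPairs.1 hi)
  unique hj hk := (w⁻¹).injective (hF.unique (mem_permPairs.1 hj) (mem_permPairs.1 hk))

theorem permPairs_permPairs (w v : Equiv.Perm α) (F : Finset (Sym2 α)) :
    permPairs w (permPairs v F) = permPairs (w * v) F := by
  ext z
  induction z with
  | _ i j => simp [mem_permPairs]

theorem IsMatching.insert {F : Finset (Sym2 α)} (hF : IsMatching F) {i j : α} (hij : i ≠ j)
    (hi : ∀ k, s(i, k) ∉ F) (hj : ∀ k, s(j, k) ∉ F) : IsMatching (insert s(i, j) F) := by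
  constructor
  · intro k hk
    rcases Finset.mem_insert.1 hk with h | h
    · grind [Sym2.eq_iff]
    · exact hF.irrefl k h
  · intro a b c hb hc
    rcases Finset.mem_insert.1 hb with hb | hb <;> rcases Finset.mem_insert.1 hc with hc | hc
    · grind [Sym2.eq_iff]
    · grind [Sym2.eq_iff]
    · grind [Sym2.eq_iff]
    · exact hF.unique hb hc

/-- A monoid with permutations, hooks (both brackets `{i, j}`, `{i', j'}`) and points (both points
`{i}`, `{i'}`) satisfying those equations of the partial Brauer monoid on the index set `α` which
are used for the reduction to normal forms. -/
structure RookBrauerSystem (α : Type*) [DecidableEq α] (M : Type*) [Monoid M] where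
  /-- The permutations. -/
  perm : Equiv.Perm α →* M
  /-- The hooks; the values on the diagonal are irrelevant. -/
  hook : Sym2 α → M
  /-- The points. -/
  pt : α → M
  perm_mul_hook (w : Equiv.Perm α) (z : Sym2 α) : perm w * hook z = hook (z.map w) * perm w
  perm_mul_pt (w : Equiv.Perm α) (i : α) : perm w * pt i = pt (w i) * perm w
  hook_sq {i j : α} (h : i ≠ j) : hook s(i, j) * hook s(i, j) = hook s(i, j)
  hook_comm {i j k l : α} (hij : i ≠ j) (hkl : k ≠ l) (hik : i ≠ k) (hil : i ≠ l) (hjk : j ≠ k)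
    (hjl : j ≠ l) : Commute (hook s(i, j)) (hook s(k, l))
  hook_mul_hook {i j k : α} (hij : i ≠ j) (hik : i ≠ k) (hjk : j ≠ k) :
    hook s(i, k) * hook s(i, j) = perm (Equiv.swap j k) * hook s(i, j)
  pt_sq (i : α) : pt i * pt i = pt i
  pt_comm (i j : α) : Commute (pt i) (pt j)
  pt_mul_swap {i j : α} (h : i ≠ j) : pt i * pt j * perm (Equiv.swap i j) = pt i * pt j
  pt_comm_hook {i j k : α} (hij : i ≠ j) (hki : k ≠ i) (hkj : k ≠ j) :
    Commute (pt k) (hook s(i, j))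
  pt_mul_hook {i j : α} (h : i ≠ j) : pt i * hook s(i, j) = pt i * pt j * hook s(i, j)
  hook_pt_hook {i j : α} (h : i ≠ j) :
    hook s(i, j) * (pt i * pt j) * hook s(i, j) = hook s(i, j)
  pt_hook_pt {i j : α} (h : i ≠ j) : pt i * pt j * hook s(i, j) * pt i = pt i * pt j

/-- A diagram of the partial Brauer monoid: the brackets on either side, and the lines
`{w i, i'}` for `i ∉ pts`, where `w` is the permutation `perm`. The pins on neither a bracket nor a
line are points. The values of `w` at `pts` do not matter. -/
structure NormalForm (α : Type*) [DecidableEq α] where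
  /-- The left brackets. -/
  left : Finset (Sym2 α)
  /-- The permutation which contains the lines. -/
  perm : Equiv.Perm α
  /-- The right pins which are not on a line. -/
  pts : Finset α
  /-- The right brackets. -/
  right : Finset (Sym2 α)
  isMatching_left : IsMatching left
  isMatching_right : IsMatching right
  mem_pts_of_left {i j : α} : s(perm i, j) ∈ left → i ∈ pts
  mem_pts_of_right {i j : α} : s(i, j) ∈ right → i ∈ pts

namespace NormalForm

/-- The normal form of the product by a permutation from the right. -/
def mulPerm (d : NormalForm α) (v : Equiv.Perm α) : NormalForm α where
  left := d.left
  perm := d.perm * v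
  pts := d.pts.image (v⁻¹ : Equiv.Perm α)
  right := permPairs v⁻¹ d.right
  isMatching_left := d.isMatching_left
  isMatching_right := d.isMatching_right.permPairs _
  mem_pts_of_left {i _} h := Finset.mem_image.2 ⟨v i, d.mem_pts_of_left h, by simp⟩
  mem_pts_of_right {i _} h :=
    Finset.mem_image.2 ⟨v i, d.mem_pts_of_right (mem_permPairs.1 (by simpa using h)), by simp⟩

/-- The normal form in which a right bracket is replaced by two points. -/
def eraseRight (d : NormalForm α) (i j : α) : NormalForm α where
  left := d.left
  perm := d.perm
  pts := d.pts
  right := d.right.erase s(i, j)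
  isMatching_left := d.isMatching_left
  isMatching_right := d.isMatching_right.mono (Finset.erase_subset _ _)
  mem_pts_of_left := d.mem_pts_of_left
  mem_pts_of_right h := d.mem_pts_of_right (Finset.mem_of_mem_erase h)

theorem notMem_eraseRight_left (d : NormalForm α) {i j : α} (h : s(i, j) ∈ d.right) (k : α) :
    s(i, k) ∉ (d.eraseRight i j).right := by
  intro hk
  obtain rfl := d.isMatching_right.unique (Finset.mem_of_mem_erase hk) h
  simp [eraseRight] at hk

theorem notMem_eraseRight_right (d : NormalForm α) {i j : α} (h : s(i, j) ∈ d.right) (k : α) :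
    s(j, k) ∉ (d.eraseRight i j).right := by
  intro hk
  obtain rfl := d.isMatching_right.unique (Finset.mem_of_mem_erase hk) (Sym2.eq_swap ▸ h)
  simp [eraseRight, Sym2.eq_swap] at hk

end NormalForm

namespace RookBrauerSystem

variable {M : Type*} [Monoid M] (S : RookBrauerSystem α M)

/-- The product of the hooks at the elements of a finite set of pairs, in some order; for a matching
the hooks commute, so that the order does not matter. -/
noncomputable def hookProd (F : Finset (Sym2 α)) : M := (F.toList.map S.hook).prod

/-- The product of the points at the elements of a finite set. -/
def ptProd (B : Finset α) : M := B.noncommProd S.pt fun i _ j _ _ => S.pt_comm i j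

/-- The element of `M` described by a normal form. -/
noncomputable def eval (d : NormalForm α) : M :=
  S.hookProd d.left * S.perm d.perm * S.ptProd d.pts * S.hookProd d.right

theorem commute_hook {F : Finset (Sym2 α)} (hF : IsMatching F) {z z' : Sym2 α} (hz : z ∈ F)
    (hz' : z' ∈ F) (hne : z ≠ z') : Commute (S.hook z) (S.hook z') := by
  induction z with | _ i j =>
  induction z' with | _ k l =>
  have h1 := hF.irrefl
  have h2 := @hF.unique
  apply S.hook_comm <;> rintro rfl <;> grind [Sym2.eq_swap]

theorem hookProd_empty : S.hookProd ∅ = 1 := by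
  simp [hookProd]

theorem hookProd_insert {F : Finset (Sym2 α)} {z : Sym2 α} (hF : IsMatching (insert z F))
    (hz : z ∉ F) : S.hookProd (insert z F) = S.hook z * S.hookProd F := by
  have h1 := (Finset.toList_insert hz).map S.hook
  have h2 : ((insert z F).toList.map S.hook).Pairwise Commute := by
    rw [List.pairwise_map]
    refine (Finset.nodup_toList _).pairwise_of_forall_ne fun a ha b hb hab => ?_
    exact S.commute_hook hF (Finset.mem_toList.1 ha) (Finset.mem_toList.1 hb) hab
  rw [hookProd, h1.prod_eq' h2]
  simp [hookProd]

theorem perm_mul_hookProd (w : Equiv.Perm α) {F : Finset (Sym2 α)} (hF : IsMatching F) :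
    S.perm w * S.hookProd F = S.hookProd (permPairs w F) * S.perm w := by
  induction F using Finset.induction_on with
  | empty => simp [permPairs, hookProd_empty]
  | insert z F hz ih =>
    have e : permPairs w (insert z F) = insert (z.map w) (permPairs w F) :=
      Finset.image_insert _ _ _
    have h1 := hF.permPairs w
    rw [e] at h1 ⊢
    rw [S.hookProd_insert hF hz, S.hookProd_insert h1, ← mul_assoc, S.perm_mul_hook, mul_assoc,
      ih (hF.mono (Finset.subset_insert _ _)), mul_assoc]
    induction z with | _ i j =>
    simpa [mem_permPairs] using hz

theorem commute_hookProd {F : Finset (Sym2 α)} {x : M} (h : ∀ i j, s(i, j) ∈ F →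
    Commute x (S.hook s(i, j))) : Commute x (S.hookProd F) := by
  refine Commute.list_prod_right _ _ fun y hy => ?_
  obtain ⟨z, hz, rfl⟩ := List.mem_map.1 hy
  induction z with | _ i j => exact h i j (Finset.mem_toList.1 hz)

theorem commute_pt_hookProd {F : Finset (Sym2 α)} (hF : IsMatching F) {i : α}
    (hi : ∀ j, s(i, j) ∉ F) : Commute (S.pt i) (S.hookProd F) := by
  refine S.commute_hookProd fun j k hjk => S.pt_comm_hook ?_ ?_ ?_
  · rintro rfl
    exact hF.irrefl _ hjk
  · rintro rfl
    exact hi _ hjk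
  · rintro rfl
    exact hi _ (Sym2.eq_swap ▸ hjk)

theorem commute_hook_hookProd {F : Finset (Sym2 α)} (hF : IsMatching F) {i j : α} (hij : i ≠ j)
    (hi : ∀ k, s(i, k) ∉ F) (hj : ∀ k, s(j, k) ∉ F) :
    Commute (S.hook s(i, j)) (S.hookProd F) := by
  refine S.commute_hookProd fun k l hkl => S.hook_comm hij ?_ ?_ ?_ ?_ ?_
  · rintro rfl
    exact hF.irrefl _ hkl
  · rintro rfl
    exact hi _ hkl
  · rintro rfl
    exact hi _ (Sym2.eq_swap ▸ hkl)
  · rintro rfl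
    exact hj _ hkl
  · rintro rfl
    exact hj _ (Sym2.eq_swap ▸ hkl)

theorem ptProd_empty : S.ptProd ∅ = 1 := Finset.noncommProd_empty _ _

theorem ptProd_insert_of_notMem {B : Finset α} {i : α} (h : i ∉ B) :
    S.ptProd (insert i B) = S.pt i * S.ptProd B :=
  Finset.noncommProd_insert_of_notMem _ _ _ _ h

theorem commute_pt_ptProd (i : α) (B : Finset α) : Commute (S.pt i) (S.ptProd B) :=
  Finset.noncommProd_commute _ _ _ _ fun j _ => S.pt_comm i j

theorem pt_mul_ptProd {B : Finset α} {i : α} (h : i ∈ B) : S.pt i * S.ptProd B = S.ptProd B := by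
  rw [← Finset.insert_erase h, S.ptProd_insert_of_notMem (Finset.notMem_erase _ _), ← mul_assoc,
    S.pt_sq]

theorem ptProd_mul_pt {B : Finset α} {i : α} (h : i ∈ B) : S.ptProd B * S.pt i = S.ptProd B := by
  rw [← (S.commute_pt_ptProd i B).eq, S.pt_mul_ptProd h]

theorem ptProd_insert (B : Finset α) (i : α) : S.ptProd (insert i B) = S.ptProd B * S.pt i := by
  by_cases h : i ∈ B
  · rw [Finset.insert_eq_of_mem h, S.ptProd_mul_pt h]
  · rw [S.ptProd_insert_of_notMem h, (S.commute_pt_ptProd i B).eq]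

theorem perm_mul_ptProd (w : Equiv.Perm α) (B : Finset α) :
    S.perm w * S.ptProd B = S.ptProd (B.image w) * S.perm w := by
  induction B using Finset.induction_on with
  | empty => simp [ptProd_empty]
  | insert i B hi ih =>
    rw [Finset.image_insert, ptProd_insert, ptProd_insert, ← mul_assoc, ih, mul_assoc,
      S.perm_mul_pt, mul_assoc]

/-- A permutation which moves only elements of `B` is absorbed by the points at `B`. -/
theorem perm_mul_ptProd_eq_self [Fintype α] {u : Equiv.Perm α} {B : Finset α}
    (hu : ∀ i, i ∉ B → u i = i) : S.perm u * S.ptProd B = S.ptProd B := by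
  have hB : ∀ i, i ∈ B ↔ u i ∈ B := by
    intro i
    constructor
    · intro hi
      by_contra h
      rw [u.injective (hu _ h)] at h
      exact h hi
    · intro hi
      by_contra h
      rw [hu i h] at hi
      exact h hi
  have hsub : Equiv.Perm.ofSubtype (u.subtypePerm (p := (· ∈ B)) fun i => (hB i).symm) = u := by
    refine Equiv.Perm.ofSubtype_subtypePerm _ fun i hi => ?_
    by_contra h
    exact hi (hu i h)
  rw [← hsub]
  generalize u.subtypePerm (p := (· ∈ B)) _ = v
  induction v using Equiv.Perm.swap_induction_on with
  | one => simp
  | swap_mul f x y hxy ih =>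
    rw [map_mul, map_mul, mul_assoc, ih, Equiv.Perm.ofSubtype_swap_eq]
    have hxy' : (x : α) ≠ y := fun h => hxy (Subtype.ext h)
    have hswap : S.perm (Equiv.swap (x : α) y) * (S.pt x * S.pt y) = S.pt x * S.pt y := by
      rw [← mul_assoc, S.perm_mul_pt, mul_assoc, S.perm_mul_pt, ← mul_assoc, Equiv.swap_apply_left,
        Equiv.swap_apply_right, Equiv.swap_comm, S.pt_mul_swap hxy'.symm, (S.pt_comm _ _).eq]
    rw [← S.pt_mul_ptProd x.2, ← S.pt_mul_ptProd y.2, ← mul_assoc, ← mul_assoc,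
      mul_assoc (S.perm _), hswap, mul_assoc]

theorem commute_hook_ptProd {i j : α} (hij : i ≠ j) {B : Finset α} (hi : i ∉ B) (hj : j ∉ B) :
    Commute (S.hook s(i, j)) (S.ptProd B) := by
  refine Finset.noncommProd_commute _ _ _ _ fun k hk => (S.pt_comm_hook hij ?_ ?_).symm
  · rintro rfl
    exact hi hk
  · rintro rfl
    exact hj hk

/-- The value of a normal form does not depend on the values of its permutation at `pts`. -/
theorem eval_congr [Fintype α] {d d' : NormalForm α} (hl : d.left = d'.left)
    (hr : d.right = d'.right) (hp : d.pts = d'.pts) (hw : ∀ i, i ∉ d.pts → d.perm i = d'.perm i) :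
    S.eval d = S.eval d' := by
  have h := S.perm_mul_ptProd_eq_self (u := d'.perm⁻¹ * d.perm) (B := d.pts) fun i hi => by
    simp [hw i hi]
  rw [eval, eval, ← hl, ← hr, ← hp, ← mul_inv_cancel_left d'.perm d.perm, map_mul]
  simp only [mul_assoc] at h ⊢
  rw [← mul_assoc _ (S.ptProd _), h]

theorem eval_mulPerm (d : NormalForm α) (v : Equiv.Perm α) :
    S.eval (d.mulPerm v) = S.eval d * S.perm v := by
  have h1 := S.perm_mul_hookProd v (d.isMatching_right.permPairs v⁻¹)
  have h2 := S.perm_mul_ptProd v (d.pts.image (v⁻¹ : Equiv.Perm α))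
  rw [permPairs_permPairs, mul_inv_cancel] at h1
  have e1 : permPairs 1 d.right = d.right := by simp [permPairs]
  have e2 : (d.pts.image (v⁻¹ : Equiv.Perm α)).image v = d.pts := by
    rw [Finset.image_image, ← Equiv.Perm.coe_mul]
    simp
  rw [e1] at h1
  rw [e2] at h2
  simp only [eval, NormalForm.mulPerm, map_mul]
  rw [mul_assoc _ (S.hookProd d.right), ← h1]
  simp only [← mul_assoc]
  rw [mul_assoc _ (S.ptProd d.pts), ← h2]
  simp only [← mul_assoc]

theorem eval_eraseRight (d : NormalForm α) {i j : α} (h : s(i, j) ∈ d.right) :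
    S.eval d = S.eval (d.eraseRight i j) * S.hook s(i, j) := by
  have hF : IsMatching (insert s(i, j) (d.right.erase s(i, j))) := by
    rw [Finset.insert_erase h]
    exact d.isMatching_right
  have hE : S.hookProd d.right = S.hook s(i, j) * S.hookProd (d.right.erase s(i, j)) := by
    rw [← S.hookProd_insert hF (Finset.notMem_erase _ _), Finset.insert_erase h]
  have hC := (S.commute_hook_hookProd (d.eraseRight i j).isMatching_right (d.isMatching_right.ne h)
    (d.notMem_eraseRight_left h) (d.notMem_eraseRight_right h)).eq
  rw [NormalForm.eraseRight] at hC
  rw [hC] at hE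
  simp only [eval, hE, NormalForm.eraseRight, mul_assoc]

theorem eval_mul_pt_of_free (d : NormalForm α) {i : α} (h : ∀ j, s(i, j) ∉ d.right) :
    S.eval d * S.pt i =
      S.hookProd d.left * S.perm d.perm * S.ptProd (insert i d.pts) * S.hookProd d.right := by
  rw [S.ptProd_insert, eval, mul_assoc, ← (S.commute_pt_hookProd d.isMatching_right h).eq]
  simp only [mul_assoc]

theorem eval_mul_pt_of_mem (d : NormalForm α) {i : α} (h : ∀ j, s(i, j) ∉ d.right)
    (hi : i ∈ d.pts) : S.eval d * S.pt i = S.eval d := by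
  rw [S.eval_mul_pt_of_free d h, Finset.insert_eq_of_mem hi, eval]

/-- Normal forms are closed under the multiplication by points. -/
theorem exists_eval_eq_mul_pt (d : NormalForm α) (i : α) :
    ∃ d', S.eval d' = S.eval d * S.pt i := by
  by_cases h : ∃ j, s(i, j) ∈ d.right
  · -- The bracket `{i, j}` becomes a pair of points, which the normal form has recorded already.
    obtain ⟨j, hj⟩ := h
    refine ⟨d.eraseRight i j, ?_⟩
    have h1 := S.eval_mul_pt_of_mem (d.eraseRight i j) (d.notMem_eraseRight_left hj)
      (d.mem_pts_of_right hj)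
    have h2 := S.eval_mul_pt_of_mem (d.eraseRight i j) (d.notMem_eraseRight_right hj)
      (d.mem_pts_of_right (Sym2.eq_swap ▸ hj))
    have h3 : S.eval (d.eraseRight i j) * (S.pt i * S.pt j) = S.eval (d.eraseRight i j) := by
      rw [← mul_assoc, h1, h2]
    have h4 := congrArg (S.eval (d.eraseRight i j) * ·) (S.pt_hook_pt (d.isMatching_right.ne hj))
    simp only [← mul_assoc, h1, h2] at h4
    rw [S.eval_eraseRight d hj, h4]
  · push Not at h
    refine ⟨⟨d.left, d.perm, insert i d.pts, d.right, d.isMatching_left, d.isMatching_right,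
      fun h => Finset.mem_insert_of_mem (d.mem_pts_of_left h),
      fun h => Finset.mem_insert_of_mem (d.mem_pts_of_right h)⟩, ?_⟩
    rw [S.eval_mul_pt_of_free d h, eval]

/-- The product of a normal form by a hook at two places which do not lie on right brackets, one of
which is not on a line: the line through the other one, if any, is cut. -/
theorem exists_eval_eq_mul_hook_of_mem (d : NormalForm α) {i j : α} (hij : i ≠ j)
    (hi : ∀ k, s(i, k) ∉ d.right) (hj : ∀ k, s(j, k) ∉ d.right) (hip : i ∈ d.pts) :
    ∃ d', S.eval d' = S.eval d * S.hook s(i, j) := by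
  refine ⟨⟨d.left, d.perm, insert j d.pts, insert s(i, j) d.right, d.isMatching_left,
    d.isMatching_right.insert hij hi hj, fun h => Finset.mem_insert_of_mem (d.mem_pts_of_left h),
    fun {a b} h => ?_⟩, ?_⟩
  · rcases Finset.mem_insert.1 h with h | h
    · rcases Sym2.eq_iff.1 h with ⟨rfl, rfl⟩ | ⟨rfl, rfl⟩ <;> simp [hip]
    · exact Finset.mem_insert_of_mem (d.mem_pts_of_right h)
  · have h1 : S.eval d * S.hook s(i, j) = S.eval d * S.pt j * S.hook s(i, j) := by
      rw [← S.eval_mul_pt_of_mem d hi hip, mul_assoc, S.pt_mul_hook hij]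
      simp only [← mul_assoc]
    have h2 := S.commute_hook_hookProd d.isMatching_right hij hi hj
    rw [h1, S.eval_mul_pt_of_free d hj, mul_assoc, ← h2.eq,
      ← S.hookProd_insert (d.isMatching_right.insert hij hi hj) (hi j), eval]

/-- The product of a normal form by a hook at two places which lie on lines: the other ends of these
lines are joined by a left bracket. -/
theorem exists_eval_eq_mul_hook_of_notMem (d : NormalForm α) {i j : α} (hij : i ≠ j)
    (hip : i ∉ d.pts) (hjp : j ∉ d.pts) : ∃ d', S.eval d' = S.eval d * S.hook s(i, j) := by
  have hi : ∀ k, s(i, k) ∉ d.right := fun k h => hip (d.mem_pts_of_right h)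
  have hj : ∀ k, s(j, k) ∉ d.right := fun k h => hjp (d.mem_pts_of_right h)
  have hi' : ∀ k, s(d.perm i, k) ∉ d.left := fun k h => hip (d.mem_pts_of_left h)
  have hj' : ∀ k, s(d.perm j, k) ∉ d.left := fun k h => hjp (d.mem_pts_of_left h)
  have hw : d.perm i ≠ d.perm j := fun h => hij (d.perm.injective h)
  refine ⟨⟨insert s(d.perm i, d.perm j) d.left, d.perm, insert j (insert i d.pts),
    insert s(i, j) d.right, d.isMatching_left.insert hw hi' hj',
    d.isMatching_right.insert hij hi hj, fun {a b} h => ?_, fun {a b} h => ?_⟩, ?_⟩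
  · rcases Finset.mem_insert.1 h with h | h
    · rcases Sym2.eq_iff.1 h with ⟨h, -⟩ | ⟨h, -⟩ <;> rw [d.perm.injective h] <;> simp
    · exact Finset.mem_insert_of_mem (Finset.mem_insert_of_mem (d.mem_pts_of_left h))
  · rcases Finset.mem_insert.1 h with h | h
    · rcases Sym2.eq_iff.1 h with ⟨rfl, rfl⟩ | ⟨rfl, rfl⟩ <;> simp
    · exact Finset.mem_insert_of_mem (Finset.mem_insert_of_mem (d.mem_pts_of_right h))
  · have h1 : S.perm d.perm * S.ptProd d.pts * S.hook s(i, j) =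
        S.hook s(d.perm i, d.perm j) * (S.perm d.perm * S.ptProd (insert j (insert i d.pts)) *
          S.hook s(i, j)) := by
      have h2 : S.perm d.perm * S.hook s(i, j) =
          S.hook s(d.perm i, d.perm j) * S.perm d.perm := S.perm_mul_hook _ _
      have h3 := (S.commute_hook_ptProd hij hip hjp).eq
      -- The hook is doubled: one copy becomes the left bracket, the other one the right bracket,
      -- and the points in between cut the two lines.
      conv_lhs => rw [← S.hook_pt_hook hij]
      rw [S.ptProd_insert, S.ptProd_insert, ← mul_assoc, ← mul_assoc, mul_assoc _ (S.ptProd _),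
        ← h3, ← mul_assoc _ (S.hook _), h2]
      simp only [mul_assoc]
    have h4 : S.hookProd d.right * S.hook s(i, j) = S.hook s(i, j) * S.hookProd d.right :=
      (S.commute_hook_hookProd d.isMatching_right hij hi hj).symm.eq
    have h5 := (S.commute_hook_hookProd d.isMatching_left hw hi' hj').eq
    simp only [eval]
    rw [S.hookProd_insert (d.isMatching_right.insert hij hi hj) (hi j),
      S.hookProd_insert (d.isMatching_left.insert hw hi' hj') (hi' _), h5]
    have h6 := congrArg (· * S.hookProd d.right) h1
    simp only [mul_assoc] at h6 ⊢
    rw [h4, h6]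

/-- Normal forms are closed under the multiplication by hooks. -/
theorem exists_eval_eq_mul_hook (d : NormalForm α) {i j : α} (hij : i ≠ j) :
    ∃ d', S.eval d' = S.eval d * S.hook s(i, j) := by
  have free : ∀ (d : NormalForm α) {i j : α}, i ≠ j → (∀ k, s(i, k) ∉ d.right) →
      (∀ k, s(j, k) ∉ d.right) → ∃ d', S.eval d' = S.eval d * S.hook s(i, j) := by
    intro d i j hij hi hj
    by_cases hip : i ∈ d.pts
    · exact S.exists_eval_eq_mul_hook_of_mem d hij hi hj hip
    by_cases hjp : j ∈ d.pts
    · rw [Sym2.eq_swap]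
      exact S.exists_eval_eq_mul_hook_of_mem d hij.symm hj hi hjp
    exact S.exists_eval_eq_mul_hook_of_notMem d hij hip hjp
  -- If `i` lies on a right bracket `{i, k}`, then multiplying by the hook at `i`, `j` moves `j`
  -- to `k`.
  have bracket : ∀ (d : NormalForm α) {i j k : α}, i ≠ j → s(i, k) ∈ d.right →
      ∃ d', S.eval d' = S.eval d * S.hook s(i, j) := by
    intro d i j k hij hik
    rw [S.eval_eraseRight d hik, mul_assoc]
    have hne := d.isMatching_right.ne hik
    by_cases hjk : j = k
    · subst hjk
      exact ⟨d, by rw [S.hook_sq hij, S.eval_eraseRight d hik]⟩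
    · rw [S.hook_mul_hook hij hne hjk, ← mul_assoc, ← S.eval_mulPerm]
      refine free _ hij (fun l hl => ?_) (fun l hl => ?_)
      · have := mem_permPairs.1 hl
        rw [inv_inv, Equiv.swap_apply_of_ne_of_ne hij hne] at this
        exact d.notMem_eraseRight_left hik _ this
      · have := mem_permPairs.1 hl
        rw [inv_inv, Equiv.swap_apply_left] at this
        exact d.notMem_eraseRight_right hik _ this
  by_cases hi : ∃ k, s(i, k) ∈ d.right
  · obtain ⟨k, hk⟩ := hi
    exact bracket d hij hk
  by_cases hj : ∃ k, s(j, k) ∈ d.right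
  · obtain ⟨k, hk⟩ := hj
    rw [Sym2.eq_swap]
    exact bracket d hij.symm hk
  · push Not at hi hj
    exact free d hij hi hj

end RookBrauerSystem

end NormalForms

end RookBrauer

namespace RookBrauer

open PartitionMonoid (lo hi)

/-! ### Permutations, hooks and points in the presented monoid -/

/-- Conjugation by the image of a group element. -/
def conjHom {G M : Type*} [Group G] [Monoid M] (f : G →* M) (g : G) : M →* M where
  toFun x := f g * x * f g⁻¹
  map_one' := by rw [mul_one, ← map_mul, mul_inv_cancel, map_one]
  map_mul' x y := by
    have h : f g⁻¹ * f g = 1 := by rw [← map_mul, inv_mul_cancel, map_one]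
    simp only [mul_assoc]
    rw [← mul_assoc (f g⁻¹) (f g), h, one_mul]

section conjHom

variable {G M : Type*} [Group G] [Monoid M] (f : G →* M)

theorem conjHom_mul_self (g : G) (x : M) : conjHom f g x * f g = f g * x := by
  change f g * x * f g⁻¹ * f g = f g * x
  rw [mul_assoc, ← map_mul, inv_mul_cancel, map_one, mul_one]

theorem conjHom_eq_iff {g : G} {x y : M} : conjHom f g x = y ↔ f g * x = y * f g := by
  constructor
  · rintro rfl
    rw [conjHom_mul_self]
  · intro h
    change f g * x * f g⁻¹ = y
    rw [h, mul_assoc, ← map_mul, mul_inv_cancel, map_one, mul_one]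

theorem conjHom_conjHom (g h : G) (x : M) : conjHom f g (conjHom f h x) = conjHom f (g * h) x := by
  change f g * (f h * x * f h⁻¹) * f g⁻¹ = f (g * h) * x * f (g * h)⁻¹
  simp only [mul_inv_rev, map_mul, mul_assoc]

theorem conjHom_map (g h : G) : conjHom f g (f h) = f (g * h * g⁻¹) := by
  change f g * f h * f g⁻¹ = _
  simp only [map_mul]

end conjHom

namespace T

variable {n : ℕ}

/-- The generator `σᵢ` of `T`. -/
def sig (i : Fin (n - 1)) : T n := PresentedMonoid.of (Rel n) (Gen.sigma i)

/-- The generator `θᵢ` of `T`. -/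
def the (i : Fin (n - 1)) : T n := PresentedMonoid.of (Rel n) (Gen.theta i)

/-- The generator `ϑᵢ` of `T`. -/
def vth (i : Fin n) : T n := PresentedMonoid.of (Rel n) (Gen.vartheta i)

theorem eq_of_rel {x y : FreeMonoid (Gen n)} (h : Rel n x y) :
    PresentedMonoid.mk (Rel n) x = PresentedMonoid.mk (Rel n) y :=
  PresentedMonoid.mk_eq_mk_of_rel h

theorem sig_sq (i : Fin (n - 1)) : sig i * sig i = 1 := eq_of_rel (Rel.sigma_sq i)

/-- The generator `σᵢ` as a unit. -/
def sigUnit (i : Fin (n - 1)) : (T n)ˣ := ⟨sig i, sig i, sig_sq i, sig_sq i⟩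

theorem isCoxeterFamily_sigUnit_adjSwap : IsCoxeterFamily fun k : Fin (n - 1) =>
    ((sigUnit k, adjSwap k) : (T n)ˣ × Equiv.Perm (Fin n)) where
  sq i := Prod.ext (Units.ext (sig_sq i)) ((isCoxeterFamily_adjSwap n).sq i)
  comm i j h := Prod.ext (Units.ext (eq_of_rel (Rel.sigma_comm i j h)))
    ((isCoxeterFamily_adjSwap n).comm i j h)
  braid i j h := Prod.ext (Units.ext (eq_of_rel (Rel.sigma_braid i j h)))
    ((isCoxeterFamily_adjSwap n).braid i j h)

/-- The Coxeter presentation, applied to the pairs `(σₖ, sₖ)` in the product of the unit group of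
`T` with the symmetric group, gives a homomorphism to `T` whose values at the permutations fixing
the first two elements commute with the first `θ`. -/
theorem exists_perm (n : ℕ) : ∃ f : Equiv.Perm (Fin n) →* T n,
    (∀ k, f (adjSwap k) = sig k) ∧ ∀ k : Fin (n - 1), (k : ℕ) = 0 → ∀ w : Equiv.Perm (Fin n),
      w (lo k) = lo k → w (hi k) = hi k → Commute (f w) (the k) := by
  obtain ⟨f, hf, hf'⟩ := isCoxeterFamily_sigUnit_adjSwap.exists_section
    (MonoidHom.snd (T n)ˣ (Equiv.Perm (Fin n))) fun _ => rfl
  refine ⟨(Units.coeHom (T n)).comp ((MonoidHom.fst _ _).comp f), fun k => ?_, ?_⟩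
  · simp [hf, sigUnit]
  · intro k hk w h1 h2
    have hw := hf' 2 (by omega) w fun i hi' => by
      rcases (by omega : (i : ℕ) = 0 ∨ (i : ℕ) = 1) with h | h
      · rwa [(Fin.ext (h.trans hk.symm) : i = lo k)]
      · rwa [(Fin.ext (by simp [hi]; omega) : i = hi k)]
    have key : ∀ x ∈ IsCoxeterFamily.tail (fun k : Fin (n - 1) =>
        ((sigUnit k, adjSwap k) : (T n)ˣ × Equiv.Perm (Fin n))) 2, Commute (x.1 : T n) (the k) := by
      intro x hx
      induction hx using Subgroup.closure_induction with
      | mem x hx =>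
        obtain ⟨l, hl, rfl⟩ := hx
        exact (eq_of_rel (Rel.theta_sigma_comm k l (Or.inl (by omega)))).symm
      | one => exact Commute.one_left _
      | mul x y _ _ h1 h2 => exact h1.mul_left h2
      | inv x _ h => exact h.units_inv_left
    exact key _ hw

/-- The embedding of the symmetric group. -/
noncomputable def perm (n : ℕ) : Equiv.Perm (Fin n) →* T n := (exists_perm n).choose

theorem perm_adjSwap (k : Fin (n - 1)) : perm n (adjSwap k) = sig k :=
  (exists_perm n).choose_spec.1 k

theorem commute_perm_the {k : Fin (n - 1)} (hk : (k : ℕ) = 0) {w : Equiv.Perm (Fin n)}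
    (h1 : w (lo k) = lo k) (h2 : w (hi k) = hi k) : Commute (perm n w) (the k) :=
  (exists_perm n).choose_spec.2 k hk w h1 h2

theorem adjSwap_lo (k : Fin (n - 1)) : adjSwap k (lo k) = hi k := Equiv.swap_apply_left _ _

theorem adjSwap_hi (k : Fin (n - 1)) : adjSwap k (hi k) = lo k := Equiv.swap_apply_right _ _

theorem adjSwap_of_ne {k : Fin (n - 1)} {i : Fin n} (h1 : i ≠ lo k) (h2 : i ≠ hi k) :
    adjSwap k i = i := Equiv.swap_apply_of_ne_of_ne h1 h2

theorem the_mul_the_of_near {i j : Fin (n - 1)} (h : Near i j) :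
    the i * the j = sig j * sig i * the j := by
  have h1 : sig j * the i * the j = sig i * the j := eq_of_rel (Rel.sigma_theta_theta j i h.symm)
  rw [mul_assoc, ← h1, mul_assoc, ← mul_assoc (sig j), sig_sq, one_mul]

/-- Neighbouring `θ` are conjugate. -/
theorem conjHom_adjSwap_the {i j : Fin (n - 1)} (h : Near i j) :
    conjHom (perm n) (adjSwap i * adjSwap j) (the i) = the j := by
  rw [conjHom_eq_iff, map_mul, perm_adjSwap, perm_adjSwap]
  have h1 : the j * the i * sig j = the j * sig i := eq_of_rel (Rel.theta_theta_sigma j i h.symm)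
  rw [← the_mul_the_of_near h.symm, ← mul_assoc, ← h1, mul_assoc, sig_sq, mul_one]

theorem exists_conjHom_the_zero {z : Fin (n - 1)} (hz : (z : ℕ) = 0) (k : Fin (n - 1)) :
    ∃ c : Equiv.Perm (Fin n), c (lo z) = lo k ∧ c (hi z) = hi k ∧
      conjHom (perm n) c (the z) = the k := by
  obtain ⟨k, hk⟩ := k
  induction k with
  | zero =>
    obtain rfl : z = ⟨0, hk⟩ := Fin.ext hz
    exact ⟨1, rfl, rfl, by simp [conjHom_eq_iff]⟩
  | succ k ih =>
    obtain ⟨c, h1, h2, h3⟩ := ih (by omega)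
    have e : hi (⟨k, by omega⟩ : Fin (n - 1)) = lo ⟨k + 1, hk⟩ := rfl
    refine ⟨adjSwap ⟨k, by omega⟩ * adjSwap ⟨k + 1, hk⟩ * c, ?_, ?_, ?_⟩
    · have h4 : adjSwap ⟨k + 1, hk⟩ (lo (⟨k, by omega⟩ : Fin (n - 1))) = lo ⟨k, by omega⟩ :=
        adjSwap_of_ne (by simp [lo, Fin.ext_iff]) (by simp [lo, hi, Fin.ext_iff]; omega)
      rw [Equiv.Perm.mul_apply, Equiv.Perm.mul_apply, h1, h4, adjSwap_lo, e]
    · have h4 : adjSwap ⟨k, by omega⟩ (hi (⟨k + 1, hk⟩ : Fin (n - 1))) = hi ⟨k + 1, hk⟩ :=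
        adjSwap_of_ne (by simp [lo, hi, Fin.ext_iff]; omega) (by simp [hi, Fin.ext_iff])
      rw [Equiv.Perm.mul_apply, Equiv.Perm.mul_apply, h2, e, adjSwap_lo, h4]
    · rw [← conjHom_conjHom, h3]
      exact conjHom_adjSwap_the (Or.inl rfl)

/-- The conjugates of the `θₖ` depend only on the place of their bracket. -/
theorem conjHom_the_eq {w v : Equiv.Perm (Fin n)} {k l : Fin (n - 1)} (h1 : w (lo k) = v (lo l))
    (h2 : w (hi k) = v (hi l)) : conjHom (perm n) w (the k) = conjHom (perm n) v (the l) := by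
  have h0 : 0 < n - 1 := k.pos
  obtain ⟨c, hc1, hc2, hc⟩ := exists_conjHom_the_zero (z := ⟨0, h0⟩) rfl k
  obtain ⟨b, hb1, hb2, hb⟩ := exists_conjHom_the_zero (z := ⟨0, h0⟩) rfl l
  rw [← hc, ← hb, conjHom_conjHom, conjHom_conjHom]
  have h := commute_perm_the (k := ⟨0, h0⟩) rfl (w := (v * b)⁻¹ * (w * c))
    (by rw [Equiv.Perm.mul_apply, Equiv.Perm.inv_eq_iff_eq]; simp [hc1, hb1, h1])
    (by rw [Equiv.Perm.mul_apply, Equiv.Perm.inv_eq_iff_eq]; simp [hc2, hb2, h2])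
  rw [← mul_inv_cancel_left (v * b) (w * c), ← conjHom_conjHom, (conjHom_eq_iff _).2 h.eq]

theorem conjHom_the_eq_of_sym2 {w v : Equiv.Perm (Fin n)} {k l : Fin (n - 1)}
    (h : s(w (lo k), w (hi k)) = s(v (lo l), v (hi l))) :
    conjHom (perm n) w (the k) = conjHom (perm n) v (the l) := by
  rcases Sym2.eq_iff.1 h with ⟨h1, h2⟩ | ⟨h1, h2⟩
  · exact conjHom_the_eq h1 h2
  · have e : conjHom (perm n) (adjSwap l) (the l) = the l := by
      rw [conjHom_eq_iff, perm_adjSwap]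
      have h1 : sig l * the l = the l := eq_of_rel (Rel.sigma_theta l)
      have h2 : the l * sig l = the l := eq_of_rel (Rel.theta_sigma l)
      rw [h1, h2]
    rw [← e, conjHom_conjHom]
    apply conjHom_the_eq
    · rw [h1, Equiv.Perm.mul_apply, adjSwap_lo]
    · rw [h2, Equiv.Perm.mul_apply, adjSwap_hi]

open Classical in
/-- The conjugate of the generators `θₖ` which has its brackets at a given pair; on the diagonal,
where there is none, the value is `1`. -/
noncomputable def hook (z : Sym2 (Fin n)) : T n :=
  if h : ∃ y : Equiv.Perm (Fin n) × Fin (n - 1), z = s(y.1 (lo y.2), y.1 (hi y.2)) then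
    conjHom (perm n) h.choose.1 (the h.choose.2)
  else 1

theorem hook_eq (w : Equiv.Perm (Fin n)) (k : Fin (n - 1)) :
    hook s(w (lo k), w (hi k)) = conjHom (perm n) w (the k) := by
  have h : ∃ y : Equiv.Perm (Fin n) × Fin (n - 1),
      s(w (lo k), w (hi k)) = s(y.1 (lo y.2), y.1 (hi y.2)) := ⟨(w, k), rfl⟩
  rw [hook, dif_pos h]
  exact conjHom_the_eq_of_sym2 h.choose_spec.symm

theorem hook_lo_hi (k : Fin (n - 1)) : hook s(lo k, hi k) = the k :=
  (hook_eq 1 k).trans (by simp [conjHom_eq_iff])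

theorem hook_self (i : Fin n) : hook s(i, i) = 1 := by
  rw [hook, dif_neg]
  rintro ⟨y, hy⟩
  refine lo_ne_hi y.2 (y.1.injective ?_)
  rcases Sym2.eq_iff.1 hy with ⟨h1, h2⟩ | ⟨h1, h2⟩
  · rw [← h1, ← h2]
  · rw [← h1, ← h2]

/-- Any tuple of distinct elements is the image of an initial segment under a permutation. -/
theorem exists_perm_apply_eq {m : ℕ} (a : Fin m → Fin n) (ha : Function.Injective a) :
    ∃ (h : m ≤ n) (w : Equiv.Perm (Fin n)), ∀ r, w (Fin.castLE h r) = a r := by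
  have h : m ≤ n := by simpa using Fintype.card_le_of_injective a ha
  obtain ⟨w, hw⟩ := Equiv.Perm.exists_extending_pair (Fin.castLE h) a (Fin.castLE_injective h) ha
  exact ⟨h, w, hw⟩

theorem exists_perm_lo_hi {i j : Fin n} (hij : i ≠ j) :
    ∃ (w : Equiv.Perm (Fin n)) (k : Fin (n - 1)), w (lo k) = i ∧ w (hi k) = j := by
  obtain ⟨h, w, hw⟩ := exists_perm_apply_eq ![i, j] (by
    intro x y; fin_cases x <;> fin_cases y <;> simp [hij, hij.symm])
  exact ⟨w, ⟨0, by omega⟩, hw 0, hw 1⟩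

theorem exists_perm_near {i j k : Fin n} (hij : i ≠ j) (hik : i ≠ k) (hjk : j ≠ k) :
    ∃ (w : Equiv.Perm (Fin n)) (a b : Fin (n - 1)), Near a b ∧ hi a = lo b ∧
      w (lo a) = i ∧ w (hi a) = j ∧ w (hi b) = k := by
  obtain ⟨h, w, hw⟩ := exists_perm_apply_eq ![i, j, k] (by
    intro x y; fin_cases x <;> fin_cases y <;> simp [hij, hij.symm, hik, hik.symm, hjk, hjk.symm])
  exact ⟨w, ⟨0, by omega⟩, ⟨1, by omega⟩, Or.inl rfl, rfl, hw 0, hw 1, hw 2⟩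

theorem exists_perm_far {i j k l : Fin n} (hij : i ≠ j) (hkl : k ≠ l) (hik : i ≠ k) (hil : i ≠ l)
    (hjk : j ≠ k) (hjl : j ≠ l) :
    ∃ (w : Equiv.Perm (Fin n)) (a b : Fin (n - 1)), Far a b ∧
      w (lo a) = i ∧ w (hi a) = j ∧ w (lo b) = k ∧ w (hi b) = l := by
  obtain ⟨h, w, hw⟩ := exists_perm_apply_eq ![i, j, k, l] (by
    intro x y; fin_cases x <;> fin_cases y <;> simp [hij, hij.symm, hik, hik.symm, hjk, hjk.symm,
      hkl, hkl.symm, hil, hil.symm, hjl, hjl.symm])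
  exact ⟨w, ⟨0, by omega⟩, ⟨2, by omega⟩, Or.inl (by simp), hw 0, hw 1, hw 2, hw 3⟩

theorem perm_mul_vth (w : Equiv.Perm (Fin n)) (i : Fin n) :
    perm n w * vth i = vth (w i) * perm n w := by
  have hw : w ∈ Submonoid.closure (Set.range (adjSwap : Fin (n - 1) → Equiv.Perm (Fin n))) := by
    rw [closure_adjSwap]
    trivial
  induction hw using Submonoid.closure_induction generalizing i with
  | mem w hw =>
    obtain ⟨k, rfl⟩ := hw
    rw [perm_adjSwap]
    have h1 : sig k * vth (lo k) = vth (hi k) * sig k := eq_of_rel (Rel.sigma_vartheta k)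
    by_cases hl : i = lo k
    · rw [hl, adjSwap_lo, h1]
    by_cases hh : i = hi k
    · rw [hh, adjSwap_hi, ← mul_one (vth (hi k)), ← sig_sq k, ← mul_assoc (vth _), ← h1,
        ← mul_assoc, ← mul_assoc, sig_sq, one_mul]
    · rw [adjSwap_of_ne hl hh]
      exact eq_of_rel (Rel.sigma_vartheta_comm k i hl hh)
  | one => simp
  | mul x y _ _ hx hy =>
    rw [map_mul, mul_assoc, hy, ← mul_assoc, hx, mul_assoc, Equiv.Perm.mul_apply]

theorem conjHom_vth (w : Equiv.Perm (Fin n)) (i : Fin n) :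
    conjHom (perm n) w (vth i) = vth (w i) :=
  (conjHom_eq_iff _).2 (perm_mul_vth w i)

theorem vth_comm (i j : Fin n) : vth i * vth j = vth j * vth i := by
  by_cases h : i = j
  · rw [h]
  · exact eq_of_rel (Rel.vartheta_comm i j h)

theorem vth_sq (i : Fin n) : vth i * vth i = vth i := eq_of_rel (Rel.vartheta_sq i)

theorem vth_mul_vth_mul_sig (k : Fin (n - 1)) :
    vth (lo k) * vth (hi k) * sig k = vth (lo k) * vth (hi k) := by
  have h1 : sig k * vth (lo k) = vth (hi k) * sig k := eq_of_rel (Rel.sigma_vartheta k)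
  have h2 : vth (lo k) * sig k * vth (lo k) = vth (lo k) * vth (hi k) :=
    eq_of_rel (Rel.vartheta_sigma_vartheta k)
  rw [mul_assoc, ← h1, ← mul_assoc, h2]

theorem vth_mul_the (k : Fin (n - 1)) :
    vth (lo k) * the k = vth (lo k) * vth (hi k) * the k := by
  have h1 : vth (lo k) * the k = vth (hi k) * the k := eq_of_rel (Rel.vartheta_theta_lo_hi k)
  have h2 : vth (hi k) * the k = vth (lo k) * vth (hi k) * the k :=
    eq_of_rel (Rel.vartheta_theta_hi_both k)
  exact h1.trans h2

theorem the_mul_vth_mul_the (k : Fin (n - 1)) :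
    the k * (vth (lo k) * vth (hi k)) * the k = the k := by
  have h1 : the k * vth (lo k) = the k * vth (hi k) := eq_of_rel (Rel.theta_vartheta_lo_hi k)
  have h2 : the k * vth (hi k) = the k * vth (lo k) * vth (hi k) :=
    eq_of_rel (Rel.theta_vartheta_hi_both k)
  have h3 : the k * vth (lo k) * the k = the k := eq_of_rel (Rel.theta_vartheta_theta k)
  rw [← mul_assoc, ← h2, ← h1, h3]

theorem vth_mul_the_mul_vth (k : Fin (n - 1)) :
    vth (lo k) * vth (hi k) * the k * vth (lo k) = vth (lo k) * vth (hi k) := by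
  have h1 : vth (lo k) * the k * vth (lo k) = vth (lo k) * vth (hi k) :=
    eq_of_rel (Rel.vartheta_theta_vartheta k)
  rw [← vth_mul_the k, h1]

/-- The presented monoid satisfies the equations needed for the reduction to normal forms: by
conjugation with permutations these reduce to the case of neighbouring indices. -/
noncomputable def system (n : ℕ) : RookBrauerSystem (Fin n) (T n) where
  perm := perm n
  hook := hook
  pt := vth
  perm_mul_hook w z := by
    induction z with | _ i j =>
    by_cases hij : i = j
    · rw [hij, Sym2.map_mk, hook_self, hook_self, mul_one, one_mul]
    · obtain ⟨v, k, rfl, rfl⟩ := exists_perm_lo_hi hij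
      rw [← conjHom_eq_iff, hook_eq, conjHom_conjHom, ← hook_eq]
      rfl
  perm_mul_pt := perm_mul_vth
  hook_sq h := by
    obtain ⟨v, k, rfl, rfl⟩ := exists_perm_lo_hi h
    rw [hook_eq, ← map_mul]
    exact congrArg _ (eq_of_rel (Rel.theta_sq k))
  hook_comm hij hkl hik hil hjk hjl := by
    obtain ⟨v, a, b, hab, rfl, rfl, rfl, rfl⟩ := exists_perm_far hij hkl hik hil hjk hjl
    rw [hook_eq, hook_eq]
    have h : Commute (the a) (the b) := eq_of_rel (Rel.theta_comm a b hab)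
    exact h.map _
  hook_mul_hook {i j k} hij hik hjk := by
    obtain ⟨v, a, b, hab, e, rfl, rfl, rfl⟩ := exists_perm_near hik.symm hjk.symm hij
    have hs : Equiv.swap (v (hi b)) (v (lo a)) =
        v * (adjSwap b * adjSwap a * adjSwap b) * v⁻¹ := by
      have h1 : lo a ≠ hi b := fun h => hjk (congrArg v h.symm)
      rw [Equiv.swap_apply_apply, adjSwap, adjSwap, e,
        Equiv.swap_mul_swap_mul_swap (e ▸ lo_ne_hi a) h1]
    have h1 : perm n (adjSwap b * adjSwap a * adjSwap b) * the b = the a * the b := by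
      have h : sig b * the b = the b := eq_of_rel (Rel.sigma_theta b)
      rw [the_mul_the_of_near hab, map_mul, map_mul, perm_adjSwap, perm_adjSwap,
        mul_assoc _ (sig b) (the b), h]
    rw [Sym2.eq_swap, hook_eq, hs, ← conjHom_map, e, hook_eq, ← map_mul, ← map_mul, h1]
  pt_sq := vth_sq
  pt_comm := vth_comm
  pt_mul_swap h := by
    obtain ⟨v, k, rfl, rfl⟩ := exists_perm_lo_hi h
    rw [Equiv.swap_apply_apply, ← conjHom_map, ← conjHom_vth, ← conjHom_vth, ← map_mul, ← map_mul]
    exact congrArg _ ((congrArg _ (perm_adjSwap k)).trans (vth_mul_vth_mul_sig k))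
  pt_comm_hook {i j l} hij hki hkj := by
    obtain ⟨v, k, rfl, rfl⟩ := exists_perm_lo_hi hij
    obtain ⟨l, rfl⟩ := v.surjective l
    rw [hook_eq, ← conjHom_vth]
    have h : Commute (the k) (vth l) := eq_of_rel (Rel.theta_vartheta_comm k l
      (fun h => hki (congrArg v h)) (fun h => hkj (congrArg v h)))
    exact h.symm.map _
  pt_mul_hook h := by
    obtain ⟨v, k, rfl, rfl⟩ := exists_perm_lo_hi h
    rw [hook_eq, ← conjHom_vth, ← conjHom_vth, ← map_mul, ← map_mul, ← map_mul, vth_mul_the k]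
  hook_pt_hook h := by
    obtain ⟨v, k, rfl, rfl⟩ := exists_perm_lo_hi h
    rw [hook_eq, ← conjHom_vth, ← conjHom_vth, ← map_mul, ← map_mul, ← map_mul,
      the_mul_vth_mul_the]
  pt_hook_pt h := by
    obtain ⟨v, k, rfl, rfl⟩ := exists_perm_lo_hi h
    rw [hook_eq, ← conjHom_vth, ← conjHom_vth, ← map_mul, ← map_mul, ← map_mul,
      vth_mul_the_mul_vth]

end T

end RookBrauer

/-! ### Colourings of diagrams -/

namespace PartitionMonoid

variable {n : ℕ}

theorem ofPerm_respects (w : Equiv.Perm (Fin n)) (c d : Fin n → Prop) :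
    (ofPerm w).Respects c d ↔ ∀ j, c j ↔ d (w j) := by
  refine (generate_respects _ c d).trans ⟨fun h j => h _ _ ⟨j, rfl, rfl⟩, ?_⟩
  rintro h a b ⟨j, rfl, rfl⟩
  exact h j

theorem pi_respects (i : Fin (n - 1)) (c d : Fin n → Prop) :
    (pi i).Respects c d ↔
      (c (lo i) ↔ c (hi i)) ∧ (d (lo i) ↔ d (hi i)) ∧ ∀ j, j ≠ lo i → j ≠ hi i → (c j ↔ d j) := by
  refine (generate_respects _ c d).trans ⟨fun h => ⟨h _ _ (Or.inl ⟨rfl, rfl⟩),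
    h _ _ (Or.inr (Or.inl ⟨rfl, rfl⟩)),
    fun j h1 h2 => h _ _ (Or.inr (Or.inr ⟨j, h1, h2, rfl, rfl⟩))⟩, ?_⟩
  rintro ⟨h1, h2, h3⟩ a b (⟨rfl, rfl⟩ | ⟨rfl, rfl⟩ | ⟨j, hj, hj', rfl, rfl⟩)
  · exact h1
  · exact h2
  · exact h3 j hj hj'

theorem varsigma_respects (i : Fin n) (c d : Fin n → Prop) :
    (varsigma i).Respects c d ↔ ∀ j, j ≠ i → (c j ↔ d j) := by
  refine (generate_respects _ c d).trans ⟨fun h j hj => h _ _ ⟨j, hj, rfl, rfl⟩, ?_⟩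
  rintro h a b ⟨j, hj, rfl, rfl⟩
  exact h j hj

theorem ofPerm_mul_ofPerm (w v : Equiv.Perm (Fin n)) : ofPerm w * ofPerm v = ofPerm (v * w) := by
  refine ext_respects fun c d => ?_
  simp only [mul_respects, ofPerm_respects]
  constructor
  · rintro ⟨m, h1, h2⟩ j
    exact (h1 j).trans (h2 _)
  · intro h
    exact ⟨fun j => d (v j), h, fun j => Iff.rfl⟩

theorem ofPerm_mul_respects (w : Equiv.Perm (Fin n)) (α : PartitionMonoid n) (c d : Fin n → Prop) :
    (ofPerm w * α).Respects c d ↔ α.Respects (fun k => c (w⁻¹ k)) d := by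
  simp only [mul_respects, ofPerm_respects]
  constructor
  · rintro ⟨m, h1, h2⟩
    convert h2 using 1
    funext k
    simpa using h1 (w⁻¹ k)
  · intro h
    exact ⟨_, fun j => by simp, h⟩

theorem mul_ofPerm_respects (w : Equiv.Perm (Fin n)) (α : PartitionMonoid n) (c d : Fin n → Prop) :
    (α * ofPerm w).Respects c d ↔ α.Respects c (fun k => d (w k)) := by
  simp only [mul_respects, ofPerm_respects]
  constructor
  · rintro ⟨m, h1, h2⟩
    convert h1 using 1
    funext k
    simpa using (h2 k).symm
  · intro h
    exact ⟨_, h, fun j => by simp⟩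

end PartitionMonoid

/-! ### The defining relations hold for diagrams -/

namespace RookBrauer

open PartitionMonoid (lo hi ext_respects mul_respects pi_respects varsigma_respects
  ofPerm_mul_ofPerm ofPerm_mul_respects mul_ofPerm_respects)

variable {n : ℕ}

/-- The diagrams of the generators. -/
def Gen.diagram : Gen n → PartitionMonoid n
  | sigma i => PartitionMonoid.s i
  | theta i => PartitionMonoid.pi i
  | vartheta i => PartitionMonoid.varsigma i

theorem Far.ne {i j : Fin (n - 1)} (h : Far i j) :
    lo i ≠ lo j ∧ lo i ≠ hi j ∧ hi i ≠ lo j ∧ hi i ≠ hi j := by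
  rcases h with h | h <;> simp [lo, hi, Fin.ext_iff] <;> omega

theorem Near.eq {i j : Fin (n - 1)} (h : Near i j) :
    hi i = lo j ∧ lo i ≠ hi j ∨ hi j = lo i ∧ lo j ≠ hi i := by
  rcases h with h | h <;> simp [lo, hi, Fin.ext_iff] <;> omega

/-- The diagrams of the generators satisfy the defining relations. Both sides of a relation are
compared by their colourings: a colouring of the outer pins on one side extends to the inner pins on
the other side, and the formulas for these extensions are given explicitly. -/
theorem lift_diagram_eq_of_rel {x y : FreeMonoid (Gen n)} (h : Rel n x y) :
    FreeMonoid.lift Gen.diagram x = FreeMonoid.lift Gen.diagram y := by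
  have hX := isCoxeterFamily_adjSwap n
  have one : (1 : PartitionMonoid n) = PartitionMonoid.ofPerm 1 := rfl
  cases h with
  | sigma_sq i =>
    simp only [σ, map_mul, FreeMonoid.lift_eval_of, Gen.diagram, map_one, one]
    exact (ofPerm_mul_ofPerm _ _).trans (congrArg _ (hX.sq i))
  | sigma_comm i j h =>
    simp only [σ, map_mul, FreeMonoid.lift_eval_of, Gen.diagram, PartitionMonoid.s,
      ofPerm_mul_ofPerm]
    exact congrArg _ (hX.comm i j h).symm
  | sigma_braid i j h =>
    simp only [σ, map_mul, FreeMonoid.lift_eval_of, Gen.diagram, PartitionMonoid.s,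
      ofPerm_mul_ofPerm, ← mul_assoc]
    exact congrArg _ (hX.braid i j h)
  | theta_sq i =>
    simp only [θ, map_mul, FreeMonoid.lift_eval_of, Gen.diagram]
    refine ext_respects fun c d => ?_
    simp only [mul_respects, pi_respects]
    refine ⟨?_, fun h => ⟨c, ?_⟩⟩ <;> grind
  | theta_comm i j h =>
    simp only [θ, map_mul, FreeMonoid.lift_eval_of, Gen.diagram]
    refine ext_respects fun c d => ?_
    simp only [mul_respects, pi_respects]
    have := h.ne
    refine ⟨fun h => ⟨fun k => if k = lo j ∨ k = hi j then d k else c k, ?_⟩,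
      fun h => ⟨fun k => if k = lo j ∨ k = hi j then c k else d k, ?_⟩⟩ <;> grind
  | theta_theta_theta i j h =>
    simp only [θ, map_mul, FreeMonoid.lift_eval_of, Gen.diagram]
    refine ext_respects fun c d => ?_
    simp only [mul_respects, pi_respects]
    have h1 := lo_ne_hi i
    have h2 := lo_ne_hi j
    rcases h.eq with h3 | h3
    · refine ⟨by grind, fun h => ?_⟩
      refine ⟨fun k => if k = lo i ∨ k = hi i then c (hi j) else c k,
        ⟨fun k => if k = lo i ∨ k = hi i then c (hi j) else c k, ?_⟩, ?_⟩ <;> grind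
    · refine ⟨by grind, fun h => ?_⟩
      refine ⟨fun k => if k = lo i ∨ k = hi i then c (lo j) else c k,
        ⟨fun k => if k = lo i ∨ k = hi i then c (lo j) else c k, ?_⟩, ?_⟩ <;> grind
  | theta_sigma i =>
    simp only [θ, σ, map_mul, FreeMonoid.lift_eval_of, Gen.diagram]
    refine ext_respects fun c d => ?_
    simp only [PartitionMonoid.s, mul_ofPerm_respects, pi_respects, Equiv.swap_apply_def]
    grind
  | sigma_theta i =>
    simp only [θ, σ, map_mul, FreeMonoid.lift_eval_of, Gen.diagram]
    refine ext_respects fun c d => ?_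
    simp only [PartitionMonoid.s, ofPerm_mul_respects, pi_respects, Equiv.swap_inv,
      Equiv.swap_apply_def]
    grind
  | theta_sigma_comm i j h =>
    simp only [θ, σ, map_mul, FreeMonoid.lift_eval_of, Gen.diagram]
    refine ext_respects fun c d => ?_
    simp only [PartitionMonoid.s, ofPerm_mul_respects, mul_ofPerm_respects, pi_respects,
      Equiv.swap_inv, Equiv.swap_apply_def]
    have := h.ne
    grind
  | sigma_theta_theta i j h =>
    simp only [θ, σ, map_mul, FreeMonoid.lift_eval_of, Gen.diagram]
    refine ext_respects fun c d => ?_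
    simp only [mul_assoc, PartitionMonoid.s, ofPerm_mul_respects, Equiv.swap_inv]
    simp only [mul_respects, pi_respects, Equiv.swap_apply_def]
    have h1 := lo_ne_hi i
    have h2 := lo_ne_hi j
    rcases h.eq with h3 | h3
    · refine ⟨by grind, fun h =>
        ⟨fun k => if k = lo j ∨ k = hi j ∨ k = lo i then d (hi j) else d k, ?_⟩⟩
      grind
    · refine ⟨by grind, fun h =>
        ⟨fun k => if k = lo j ∨ k = hi j ∨ k = hi i then d (lo j) else d k, ?_⟩⟩
      grind
  | theta_theta_sigma i j h =>
    simp only [θ, σ, map_mul, FreeMonoid.lift_eval_of, Gen.diagram]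
    refine ext_respects fun c d => ?_
    simp only [PartitionMonoid.s, mul_ofPerm_respects]
    simp only [mul_respects, pi_respects, Equiv.swap_apply_def]
    have h1 := lo_ne_hi i
    have h2 := lo_ne_hi j
    rcases h.eq with h3 | h3
    · refine ⟨by grind, fun h =>
        ⟨fun k => if k = lo j ∨ k = hi j ∨ k = lo i then c (hi j) else c k, ?_⟩⟩
      grind
    · refine ⟨by grind, fun h =>
        ⟨fun k => if k = lo j ∨ k = hi j ∨ k = hi i then c (lo j) else c k, ?_⟩⟩
      grind
  | vartheta_sq i =>
    simp only [ϑ, map_mul, FreeMonoid.lift_eval_of, Gen.diagram]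
    refine ext_respects fun c d => ?_
    simp only [mul_respects, varsigma_respects]
    refine ⟨?_, fun h => ⟨c, ?_⟩⟩ <;> grind
  | vartheta_comm i j h =>
    simp only [ϑ, map_mul, FreeMonoid.lift_eval_of, Gen.diagram]
    refine ext_respects fun c d => ?_
    simp only [mul_respects, varsigma_respects]
    refine ⟨fun h => ⟨fun k => if k = j then d k else c k, ?_⟩,
      fun h => ⟨fun k => if k = j then c k else d k, ?_⟩⟩ <;> grind
  | sigma_vartheta i =>
    simp only [ϑ, σ, map_mul, FreeMonoid.lift_eval_of, Gen.diagram]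
    refine ext_respects fun c d => ?_
    simp only [PartitionMonoid.s, ofPerm_mul_respects, mul_ofPerm_respects, varsigma_respects,
      Equiv.swap_inv, Equiv.swap_apply_def]
    grind
  | sigma_vartheta_comm i j h h' =>
    simp only [ϑ, σ, map_mul, FreeMonoid.lift_eval_of, Gen.diagram]
    refine ext_respects fun c d => ?_
    simp only [PartitionMonoid.s, ofPerm_mul_respects, mul_ofPerm_respects, varsigma_respects,
      Equiv.swap_inv, Equiv.swap_apply_def]
    grind
  | vartheta_sigma_vartheta i =>
    simp only [ϑ, σ, map_mul, FreeMonoid.lift_eval_of, Gen.diagram]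
    refine ext_respects fun c d => ?_
    simp only [mul_assoc]
    rw [mul_respects, mul_respects]
    simp only [PartitionMonoid.s, ofPerm_mul_respects, varsigma_respects, Equiv.swap_inv,
      Equiv.swap_apply_def]
    have h1 := lo_ne_hi i
    refine ⟨fun h => ⟨fun k => if k = lo i then d k else c k, ?_⟩,
      fun h => ⟨fun k => if k = lo i then d (hi i) else c k, ?_⟩⟩ <;> grind
  | theta_vartheta_comm i j h h' =>
    simp only [θ, ϑ, map_mul, FreeMonoid.lift_eval_of, Gen.diagram]
    refine ext_respects fun c d => ?_
    simp only [mul_respects, pi_respects, varsigma_respects]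
    refine ⟨fun h => ⟨fun k => if k = j then d k else c k, ?_⟩,
      fun h => ⟨fun k => if k = j then c k else d k, ?_⟩⟩ <;> grind
  | theta_vartheta_lo_hi i =>
    simp only [θ, ϑ, map_mul, FreeMonoid.lift_eval_of, Gen.diagram]
    refine ext_respects fun c d => ?_
    simp only [mul_respects, pi_respects, varsigma_respects]
    refine ⟨fun h => ⟨fun k => if k = hi i then d (lo i) else d k, ?_⟩,
      fun h => ⟨fun k => if k = lo i then d (hi i) else d k, ?_⟩⟩ <;> grind
  | theta_vartheta_hi_both i =>
    simp only [θ, ϑ, map_mul, FreeMonoid.lift_eval_of, Gen.diagram]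
    refine ext_respects fun c d => ?_
    simp only [mul_respects, pi_respects, varsigma_respects]
    refine ⟨fun h => ⟨fun k => if k = hi i then d (lo i) else d k, 
        ⟨fun k => if k = hi i then d (lo i) else d k, ?_⟩, ?_⟩,
      fun h => ⟨fun k => if k = hi i then d (lo i) else d k, ?_⟩⟩ <;> grind
  | vartheta_theta_lo_hi i =>
    simp only [θ, ϑ, map_mul, FreeMonoid.lift_eval_of, Gen.diagram]
    refine ext_respects fun c d => ?_
    simp only [mul_respects, pi_respects, varsigma_respects]
    refine ⟨fun h => ⟨fun k => if k = hi i then c (lo i) else c k, ?_⟩,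
      fun h => ⟨fun k => if k = lo i then c (hi i) else c k, ?_⟩⟩ <;> grind
  | vartheta_theta_hi_both i =>
    simp only [θ, ϑ, map_mul, FreeMonoid.lift_eval_of, Gen.diagram]
    refine ext_respects fun c d => ?_
    simp only [mul_assoc, mul_respects, pi_respects, varsigma_respects]
    refine ⟨fun h => ⟨c, ?_, fun k => if k = hi i then c (lo i) else c k, ?_⟩,
      fun h => ⟨fun k => if k = hi i then c (lo i) else c k, ?_⟩⟩ <;> grind
  | theta_vartheta_theta i =>
    simp only [θ, ϑ, map_mul, FreeMonoid.lift_eval_of, Gen.diagram]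
    refine ext_respects fun c d => ?_
    simp only [mul_respects, pi_respects, varsigma_respects]
    refine ⟨?_, fun h => ⟨c, ⟨c, ?_⟩, ?_⟩⟩ <;> grind
  | vartheta_theta_vartheta i =>
    simp only [θ, ϑ, map_mul, FreeMonoid.lift_eval_of, Gen.diagram]
    refine ext_respects fun c d => ?_
    simp only [mul_respects, pi_respects, varsigma_respects]
    refine ⟨fun h => ⟨fun k => if k = lo i then d k else c k, ?_⟩,
      fun h => ⟨fun k => if k = lo i then d (hi i) else d k,
        ⟨fun k => if k = lo i then c (hi i) else c k, ?_⟩, ?_⟩⟩ <;> grind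

end RookBrauer

/-! ### The blocks of the generators -/

namespace PartitionMonoid

variable {n : ℕ}

/-- If a relation is contained in the graph of an involution, then it generates a decomposition
into blocks with at most two elements. -/
theorem isPartialBrauer_generate {r : Fin n ⊕ Fin n → Fin n ⊕ Fin n → Prop}
    (τ : Fin n ⊕ Fin n → Fin n ⊕ Fin n) (hτ : Function.Involutive τ)
    (hr : ∀ a b, r a b → b = τ a) : (generate r).IsPartialBrauer := by
  have key : ∀ a b, (generate r).rel a b → b = a ∨ b = τ a := by
    intro a b h
    induction h with
    | rel _ _ h => exact Or.inr (hr _ _ h)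
    | refl => exact Or.inl rfl
    | symm x y _ ih =>
      rcases ih with rfl | rfl
      · exact Or.inl rfl
      · exact Or.inr (hτ _).symm
    | trans x y z _ _ ih1 ih2 =>
      rcases ih1 with rfl | rfl <;> rcases ih2 with rfl | rfl
      · exact Or.inl rfl
      · exact Or.inr rfl
      · exact Or.inr rfl
      · exact Or.inl (hτ _)
  rw [isPartialBrauer_iff]
  intro a b c hab hac nab nac
  rcases key a b hab with h1 | h1
  · exact absurd h1.symm nab
  rcases key a c hac with h2 | h2
  · exact absurd h2.symm nac
  rw [h1, h2]

theorem isPartialBrauer_ofPerm (w : Equiv.Perm (Fin n)) : (ofPerm w).IsPartialBrauer := by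
  refine isPartialBrauer_generate (Sum.elim (fun j => Sum.inr (w j)) fun j => Sum.inl (w⁻¹ j)) ?_ ?_
  · rintro (j | j) <;> simp
  · rintro _ _ ⟨j, rfl, rfl⟩
    rfl

theorem isPartialBrauer_pi (i : Fin (n - 1)) : (pi i).IsPartialBrauer := by
  have h := RookBrauer.lo_ne_hi i
  refine isPartialBrauer_generate (Sum.elim
    (fun j => if j = lo i then Sum.inl (hi i) else if j = hi i then Sum.inl (lo i) else Sum.inr j)
    fun j => if j = lo i then Sum.inr (hi i) else if j = hi i then Sum.inr (lo i) else Sum.inl j)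
    ?_ ?_
  · rintro (j | j) <;> dsimp only [Sum.elim_inl, Sum.elim_inr] <;> split_ifs <;> simp_all
  · rintro _ _ (⟨rfl, rfl⟩ | ⟨rfl, rfl⟩ | ⟨j, h1, h2, rfl, rfl⟩) <;> simp [*]

theorem isPartialBrauer_varsigma (i : Fin n) : (varsigma i).IsPartialBrauer := by
  refine isPartialBrauer_generate Sum.swap (fun a => Sum.swap_swap a) ?_
  rintro _ _ ⟨j, -, rfl, rfl⟩
  rfl

end PartitionMonoid

/-! ### The homomorphism to the partial Brauer monoid -/

namespace RookBrauer

open PartitionMonoid (lo hi ext_respects mul_respects pi_respects varsigma_respects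
  one_respects ofPerm_respects ofPerm_mul_ofPerm ofPerm_mul_respects mul_ofPerm_respects)

variable {n : ℕ}

namespace T

/-- The homomorphism from the presented monoid to the monoid of all diagrams. -/
def toDiagram (n : ℕ) : T n →* PartitionMonoid n :=
  PresentedMonoid.lift Gen.diagram fun _ _ h => lift_diagram_eq_of_rel h

theorem toDiagram_of (g : Gen n) :
    toDiagram n (PresentedMonoid.of (Rel n) g) = g.diagram := rfl

theorem induction_on_right {p : T n → Prop} (t : T n) (one : p 1)
    (mul : ∀ t g, p t → p (t * PresentedMonoid.of (Rel n) g)) : p t := by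
  have ht : t ∈ Submonoid.closure (Set.range (PresentedMonoid.of (Rel n))) := by
    rw [PresentedMonoid.closure_range_of]
    trivial
  induction ht using Submonoid.closure_induction_right with
  | one => exact one
  | mul_right x _ y hy ih =>
    obtain ⟨g, rfl⟩ := hy
    exact mul x g ih

theorem toDiagram_isPartialBrauer (t : T n) : (toDiagram n t).IsPartialBrauer := by
  induction t using induction_on_right with
  | one => exact PartitionMonoid.isPartialBrauer_one
  | mul t g ih =>
    rw [map_mul, toDiagram_of]
    refine ih.mul ?_
    cases g with
    | sigma i => exact PartitionMonoid.isPartialBrauer_ofPerm _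
    | theta i => exact PartitionMonoid.isPartialBrauer_pi i
    | vartheta i => exact PartitionMonoid.isPartialBrauer_varsigma i

theorem exists_eval_eq (t : T n) : ∃ d, (system n).eval d = t := by
  induction t using induction_on_right with
  | one =>
    exact ⟨⟨∅, 1, ∅, ∅, isMatching_empty, isMatching_empty, by simp, by simp⟩, by
      simp [RookBrauerSystem.eval, RookBrauerSystem.hookProd_empty, RookBrauerSystem.ptProd_empty]⟩
  | mul t g ih =>
    obtain ⟨d, rfl⟩ := ih
    cases g with
    | sigma i =>
      exact ⟨d.mulPerm (adjSwap i), ((system n).eval_mulPerm d _).trans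
        (congrArg _ (perm_adjSwap i))⟩
    | theta i =>
      obtain ⟨d', h⟩ := (system n).exists_eval_eq_mul_hook d (lo_ne_hi i)
      exact ⟨d', h.trans (congrArg _ (hook_lo_hi i))⟩
    | vartheta i => exact (system n).exists_eval_eq_mul_pt d i

theorem toDiagram_perm (w : Equiv.Perm (Fin n)) :
    toDiagram n (perm n w) = PartitionMonoid.ofPerm w⁻¹ := by
  have hw : w ∈ Submonoid.closure (Set.range (adjSwap : Fin (n - 1) → Equiv.Perm (Fin n))) := by
    rw [closure_adjSwap]
    trivial
  induction hw using Submonoid.closure_induction with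
  | mem w hw =>
    obtain ⟨k, rfl⟩ := hw
    rw [perm_adjSwap, adjSwap, Equiv.swap_inv]
    exact toDiagram_of _
  | one => simp only [map_one, inv_one]; rfl
  | mul x y _ _ hx hy => rw [map_mul, map_mul, hx, hy, ofPerm_mul_ofPerm, mul_inv_rev]

theorem toDiagram_hook_respects {i j : Fin n} (hij : i ≠ j) (c d : Fin n → Prop) :
    (toDiagram n (hook s(i, j))).Respects c d ↔
      (c i ↔ c j) ∧ (d i ↔ d j) ∧ ∀ k, k ≠ i → k ≠ j → (c k ↔ d k) := by
  obtain ⟨w, k, rfl, rfl⟩ := exists_perm_lo_hi hij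
  have h : hook s(w (lo k), w (hi k)) = perm n w * the k * perm n w⁻¹ := hook_eq w k
  have h' : toDiagram n (the k) = PartitionMonoid.pi k := toDiagram_of _
  rw [h, map_mul, map_mul, toDiagram_perm, toDiagram_perm, mul_ofPerm_respects,
    ofPerm_mul_respects, h', pi_respects, inv_inv]
  refine and_congr_right fun _ => and_congr_right fun _ => ?_
  refine Iff.trans ?_ w.surjective.forall.symm
  simp only [ne_eq, w.injective.eq_iff]

theorem toDiagram_hookProd_respects {F : Finset (Sym2 (Fin n))} (hF : IsMatching F)
    (c d : Fin n → Prop) : (toDiagram n ((system n).hookProd F)).Respects c d ↔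
      (∀ i j, s(i, j) ∈ F → (c i ↔ c j) ∧ (d i ↔ d j)) ∧
        ∀ k, (∀ j, s(k, j) ∉ F) → (c k ↔ d k) := by
  induction F using Finset.induction_on generalizing c d with
  | empty =>
    simp [RookBrauerSystem.hookProd_empty, one_respects, funext_iff]
  | insert z F hz ih =>
    induction z with | _ i j =>
    have ih := ih (hF.mono (Finset.subset_insert _ _))
    have hij := hF.ne (Finset.mem_insert_self _ _)
    have hi : ∀ k, s(i, k) ∉ F := by
      intro k hk
      obtain rfl := hF.unique (Finset.mem_insert_of_mem hk) (Finset.mem_insert_self _ _)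
      exact hz hk
    have hj : ∀ k, s(j, k) ∉ F := by
      intro k hk
      obtain rfl := hF.unique (k := i) (Finset.mem_insert_of_mem hk) (by simp [Sym2.eq_swap])
      exact hz (Sym2.eq_swap ▸ hk)
    have hi' : ∀ k, s(k, i) ∉ F := fun k => Sym2.eq_swap ▸ hi k
    have hj' : ∀ k, s(k, j) ∉ F := fun k => Sym2.eq_swap ▸ hj k
    have e : (system n).hook = hook := rfl
    rw [RookBrauerSystem.hookProd_insert _ hF hz, map_mul, mul_respects, e]
    simp only [ih, toDiagram_hook_respects hij, Finset.mem_insert, Sym2.eq_iff]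
    constructor
    · rintro ⟨m, ⟨h1, h2, h3⟩, h4, h5⟩
      constructor <;> grind
    · rintro ⟨h1, h2⟩
      refine ⟨fun k => if k = i ∨ k = j then d k else c k, ?_, ?_⟩ <;> grind

theorem toDiagram_ptProd_respects (B : Finset (Fin n)) (c d : Fin n → Prop) :
    (toDiagram n ((system n).ptProd B)).Respects c d ↔ ∀ k, k ∉ B → (c k ↔ d k) := by
  induction B using Finset.induction_on generalizing c d with
  | empty =>
    simp [RookBrauerSystem.ptProd_empty, one_respects, funext_iff]
  | insert i B hi ih =>
    have h : toDiagram n ((system n).pt i) = PartitionMonoid.varsigma i := toDiagram_of _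
    rw [RookBrauerSystem.ptProd_insert_of_notMem _ hi, map_mul, mul_respects, h]
    simp only [ih, varsigma_respects]
    refine ⟨by grind, fun h => ⟨fun k => if k = i then d k else c k, ?_⟩⟩
    grind

end T

/-! ### Diagrams of normal forms -/

/-- The colourings `c`, `e` of the left and right pins which are constant on the blocks of the
diagram given by a normal form. -/
def NormalForm.Respects (d : NormalForm (Fin n)) (c e : Fin n → Prop) : Prop :=
  (∀ i j, s(i, j) ∈ d.left → (c i ↔ c j)) ∧ (∀ i j, s(i, j) ∈ d.right → (e i ↔ e j)) ∧
    ∀ i, i ∉ d.pts → (c (d.perm i) ↔ e i)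

theorem T.toDiagram_eval_respects (d : NormalForm (Fin n)) (c e : Fin n → Prop) :
    (T.toDiagram n ((T.system n).eval d)).Respects c e ↔ d.Respects c e := by
  have hp : (T.system n).perm = T.perm n := rfl
  rw [RookBrauerSystem.eval, map_mul, map_mul, map_mul, mul_respects, hp, T.toDiagram_perm]
  simp only [mul_respects, T.toDiagram_hookProd_respects d.isMatching_left,
    T.toDiagram_hookProd_respects d.isMatching_right, T.toDiagram_ptProd_respects, ofPerm_respects]
  constructor
  · rintro ⟨m₃, ⟨m₂, ⟨m₁, ⟨h1, h2⟩, h3⟩, h4⟩, h5, h6⟩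
    refine ⟨fun i j h => (h1 i j h).1, fun i j h => (h5 i j h).2, fun i hi => ?_⟩
    rw [h2 _ fun j hj => hi (d.mem_pts_of_left hj), h3,
      ← h6 _ fun j hj => hi (d.mem_pts_of_right hj), ← h4 i hi, Equiv.Perm.inv_eq_iff_eq.2 rfl]
  · rintro ⟨h1, h2, h3⟩
    exact ⟨e, ⟨fun i => c (d.perm i), ⟨c, ⟨fun i j h => ⟨h1 i j h, h1 i j h⟩, fun _ _ => Iff.rfl⟩,
      fun j => by simp⟩, h3⟩, fun i j h => ⟨h2 i j h, h2 i j h⟩, fun _ _ => Iff.rfl⟩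

namespace NormalForm

/-- If all colourings respecting `d'` respect `d`, then all brackets and lines of `d` are brackets
and lines of `d'`. -/
theorem le_of_respects {d d' : NormalForm (Fin n)} (h : ∀ c e, d'.Respects c e → d.Respects c e) :
    d.left ⊆ d'.left ∧ d.right ⊆ d'.right ∧ d'.pts ⊆ d.pts ∧
      ∀ i, i ∉ d.pts → d.perm i = d'.perm i := by
  -- the colouring of the block of the left pin `i` in the diagram of `d'`
  have hl : ∀ i, d'.Respects (fun x => x = i ∨ s(i, x) ∈ d'.left)
      (fun k => k ∉ d'.pts ∧ d'.perm k = i) := by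
    intro i
    refine ⟨fun a b hab => ?_, fun a b hab => ?_, fun k hk => ?_⟩
    · have h1 := @d'.isMatching_left.unique
      grind [Sym2.eq_swap]
    · have h1 := d'.mem_pts_of_right hab
      have h2 := d'.mem_pts_of_right (Sym2.eq_swap ▸ hab)
      simp [h1, h2]
    · have h1 : s(i, d'.perm k) ∉ d'.left := fun h => hk (d'.mem_pts_of_left (Sym2.eq_swap ▸ h))
      simp [h1, hk]
  -- the colouring of the block of the right pin `i` in the diagram of `d'`
  have hr : ∀ i, d'.Respects (fun x => i ∉ d'.pts ∧ d'.perm i = x)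
      (fun x => x = i ∨ s(i, x) ∈ d'.right) := by
    intro i
    refine ⟨fun a b hab => ?_, fun a b hab => ?_, fun k hk => ?_⟩
    · have h1 : ¬ (i ∉ d'.pts ∧ d'.perm i = a) := by
        rintro ⟨h1, rfl⟩
        exact h1 (d'.mem_pts_of_left hab)
      have h2 : ¬ (i ∉ d'.pts ∧ d'.perm i = b) := by
        rintro ⟨h1, rfl⟩
        exact h1 (d'.mem_pts_of_left (Sym2.eq_swap ▸ hab))
      simp [h1, h2]
    · have h1 := @d'.isMatching_right.unique
      grind [Sym2.eq_swap]
    · have h1 : s(i, k) ∉ d'.right := fun h => hk (d'.mem_pts_of_right (Sym2.eq_swap ▸ h))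
      simp only [h1, or_false, d'.perm.injective.eq_iff]
      grind
  have hlines : ∀ k, k ∉ d.pts → k ∉ d'.pts ∧ d'.perm k = d.perm k := fun k hk =>
    ((h _ _ (hl (d.perm k))).2.2 k hk).1 (Or.inl rfl)
  refine ⟨fun z hz => ?_, fun z hz => ?_, fun k hk => ?_, fun k hk => (hlines k hk).2.symm⟩
  · induction z with | _ i j =>
    have h1 := ((h _ _ (hl i)).1 i j hz).1 (Or.inl rfl)
    exact h1.resolve_left (d.isMatching_left.ne hz).symm
  · induction z with | _ i j =>
    have h1 := ((h _ _ (hr i)).2.1 i j hz).1 (Or.inl rfl)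
    exact h1.resolve_left (d.isMatching_right.ne hz).symm
  · by_contra hk'
    exact (hlines k hk').1 hk

/-- Every diagram of the partial Brauer monoid is given by a normal form. -/
theorem exists_respects_iff {α : PartitionMonoid n} (hα : α.IsPartialBrauer) :
    ∃ d : NormalForm (Fin n), ∀ c e, d.Respects c e ↔ α.Respects c e := by
  classical
  rw [PartitionMonoid.isPartialBrauer_iff] at hα
  have hsymm : ∀ {a b}, α.rel a b → α.rel b a := fun h => α.rel.symm' h
  -- a permutation which contains all lines
  obtain ⟨w, hw⟩ := Equiv.Perm.exists_extending_pair
    (fun k : {k : Fin n // ∃ i, α.rel (Sum.inl i) (Sum.inr k)} => (k : Fin n)) (fun k => k.2.choose)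
    Subtype.val_injective (fun k l hkl => by
      have h1 := k.2.choose_spec
      have h2 := l.2.choose_spec
      simp only at hkl
      rw [hkl] at h1
      exact Subtype.ext (Sum.inr_injective (hα _ _ _ h1 h2 (by simp) (by simp))))
  replace hw : ∀ k, (∃ i, α.rel (Sum.inl i) (Sum.inr k)) → α.rel (Sum.inl (w k)) (Sum.inr k) :=
    fun k hk => (hw ⟨k, hk⟩).symm ▸ hk.choose_spec
  have hwu : ∀ i k, α.rel (Sum.inl i) (Sum.inr k) → w k = i := fun i k h =>
    Sum.inl_injective (hα _ _ _ (hsymm (hw k ⟨i, h⟩)) (hsymm h) (by simp) (by simp))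
  let pairs (ι : Fin n → Fin n ⊕ Fin n) : Finset (Sym2 (Fin n)) :=
    Finset.univ.filter fun z => ∃ i j, z = s(i, j) ∧ i ≠ j ∧ α.rel (ι i) (ι j)
  have mem_pairs : ∀ ι i j, s(i, j) ∈ pairs ι ↔ i ≠ j ∧ α.rel (ι i) (ι j) := by
    intro ι i j
    simp only [pairs, Finset.mem_filter, Finset.mem_univ, true_and]
    constructor
    · rintro ⟨a, b, h, hab, h'⟩
      rcases Sym2.eq_iff.1 h with ⟨rfl, rfl⟩ | ⟨rfl, rfl⟩
      · exact ⟨hab, h'⟩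
      · exact ⟨hab.symm, hsymm h'⟩
    · exact fun h => ⟨i, j, rfl, h⟩
  have matching : ∀ ι : Fin n → Fin n ⊕ Fin n, Function.Injective ι → IsMatching (pairs ι) := by
    refine fun ι hι => ⟨fun i h => ((mem_pairs _ _ _).1 h).1 rfl, fun hj hk => ?_⟩
    obtain ⟨h1, h2⟩ := (mem_pairs _ _ _).1 hj
    obtain ⟨h3, h4⟩ := (mem_pairs _ _ _).1 hk
    exact hι (hα _ _ _ h2 h4 (hι.ne h1) (hι.ne h3))
  refine ⟨⟨pairs Sum.inl, w, Finset.univ.filter fun k => ¬ ∃ i, α.rel (Sum.inl i) (Sum.inr k),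
    pairs Sum.inr, matching _ Sum.inl_injective, matching _ Sum.inr_injective, fun {i j} h => ?_,
    fun {i j} h => ?_⟩, fun c e => ?_⟩
  · obtain ⟨h1, h2⟩ := (mem_pairs _ _ _).1 h
    simp only [Finset.mem_filter, Finset.mem_univ, true_and]
    intro h3
    have := hα _ _ _ h2 (hw _ h3) (Sum.inl_injective.ne h1) (by simp)
    simp at this
  · obtain ⟨h1, h2⟩ := (mem_pairs _ _ _).1 h
    simp only [Finset.mem_filter, Finset.mem_univ, true_and]
    intro h3
    have := hα _ _ _ h2 (hsymm (hw _ h3)) (Sum.inr_injective.ne h1) (by simp)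
    simp at this
  · simp only [NormalForm.Respects, mem_pairs, Finset.mem_filter, Finset.mem_univ, true_and,
      not_not]
    constructor
    · rintro ⟨h1, h2, h3⟩ (a | a) (b | b) hab
      · by_cases h : a = b
        · rw [h]
        · exact h1 a b ⟨h, hab⟩
      · have := h3 b ⟨a, hab⟩
        rwa [hwu _ _ hab] at this
      · have := h3 a ⟨b, hsymm hab⟩
        rw [hwu _ _ (hsymm hab)] at this
        exact this.symm
      · by_cases h : a = b
        · rw [h]
        · exact h2 a b ⟨h, hab⟩
    · intro h
      exact ⟨fun i j hij => h _ _ hij.2, fun i j hij => h _ _ hij.2, fun i hi => h _ _ (hw i hi)⟩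

end NormalForm

theorem T.toDiagram_injective : Function.Injective (T.toDiagram n) := by
  intro t t' htt
  obtain ⟨d, rfl⟩ := T.exists_eval_eq t
  obtain ⟨d', rfl⟩ := T.exists_eval_eq t'
  have h : ∀ c e, d.Respects c e ↔ d'.Respects c e := fun c e => by
    rw [← T.toDiagram_eval_respects, ← T.toDiagram_eval_respects, htt]
  obtain ⟨h1, h2, h3, h4⟩ := NormalForm.le_of_respects fun c e => (h c e).2
  obtain ⟨h1', h2', h3', -⟩ := NormalForm.le_of_respects fun c e => (h c e).1
  exact (T.system n).eval_congr (h1.antisymm h1') (h2.antisymm h2') (h3'.antisymm h3) h4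

theorem T.exists_toDiagram_eq {α : PartitionMonoid n} (hα : α.IsPartialBrauer) :
    ∃ t, T.toDiagram n t = α := by
  obtain ⟨d, hd⟩ := NormalForm.exists_respects_iff hα
  exact ⟨(T.system n).eval d, ext_respects fun c e => by
    rw [T.toDiagram_eval_respects, hd]⟩

end RookBrauer

theorem theorem3 (n : ℕ) :
    ∃ φ : RookBrauer.T n ≃* PartitionMonoid.partialBrauer n,
      (∀ i : Fin (n - 1),
        (φ (PresentedMonoid.of (RookBrauer.Rel n) (RookBrauer.Gen.sigma i)) : PartitionMonoid n) =
          PartitionMonoid.s i) ∧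
      (∀ i : Fin (n - 1),
        (φ (PresentedMonoid.of (RookBrauer.Rel n) (RookBrauer.Gen.theta i)) : PartitionMonoid n) =
          PartitionMonoid.pi i) ∧
      (∀ i : Fin n,
        (φ (PresentedMonoid.of (RookBrauer.Rel n) (RookBrauer.Gen.vartheta i)) :
            PartitionMonoid n) =
          PartitionMonoid.varsigma i) := by
  let f : RookBrauer.T n →* PartitionMonoid.partialBrauer n :=
    (RookBrauer.T.toDiagram n).codRestrict _ RookBrauer.T.toDiagram_isPartialBrauer
  have hf : Function.Bijective f := by
    refine ⟨fun t t' h => RookBrauer.T.toDiagram_injective (congrArg Subtype.val h), fun α => ?_⟩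
    obtain ⟨t, ht⟩ := RookBrauer.T.exists_toDiagram_eq α.2
    exact ⟨t, Subtype.ext ht⟩
  exact ⟨MulEquiv.ofBijective f hf, fun i => RookBrauer.T.toDiagram_of _,
    fun i => RookBrauer.T.toDiagram_of _, fun i => RookBrauer.T.toDiagram_of _⟩
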